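/- Let $q$ be a prime power, let $V$ be a vector space of dimension $n$ over $\mathbb F_q$, and let $2\le k\le n/2$. Call two subspaces skew if their intersection is $0$. Three distinct $k$-dimensional subspaces $A,B,C$ of $V$ form a covering triple if $A=(A\cap B)\oplus(A\cap C)$. Let $\mathcal F$ be a family of $k$-dimensional subspaces of $V$ of which no three distinct members, in any order, form a covering triple, and fix $A\in\mathcal F$. Write $[m]_q=1+q+\dots+q^{m-1}$, $[m]_q!=[1]_q[2]_q\cdots[m]_q$ and $\binom{m}{j}_q=\frac{[m]_q!}{[j]_q!\,[m-j]_q!}$ for $0\le j\le m$. Let $\mathcal F^\star$ be the set of members of $\mathcal F$ that are skew to every other member of $\mathcal F$. For $B\in\mathcal F\setminus\mathcal F^\star$: - if $A\cap B\ne 0$, put $i_A(B)=\dim(A\cap B)$ and $\mathcal I_A(B)=\{A\}$; - if $A\cap B=0$, put $i_A(B)=\min\{\dim(B\cap C): C\in\mathcal F,\ B\cap C\neq 0\}$ and $\mathcal I_A(B)=\{C\in\mathcal F:\dim(B\cap C)=i_A(B)\}$; - let $\phi_A(B)$ be the set of the $(k-i_A(B))$-dimensional subspaces $D$ of $B$ for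 which there is $C\in\mathcal I_A(B)$ with $D\cap C=0$. For $B\in\mathcal F^\star$, let $\phi_A(B)$ be the set of all subspaces of $B$. For a subspace $D$ of $V$ skew to $A$, let $\phi_A^{-1}(D)=\{B\in\mathcal F: D\in\phi_A(B)\}$. For $1\le i\le k-1$, let $\mathcal F_i=\{B\in\mathcal F\setminus\mathcal F^\star: i_A(B)=i\}\cup\mathcal F^\star$. Then, for every integer $i$ with $1\le i\le k/2$, $$|\mathcal F_i|+|\mathcal F_{k-i}|\le q^{(k-i)^2}\binom{n-k}{k-i}_q\binom{k-1}{i-1}_q+q^{i^2}\binom{n-k}{i}_q\binom{k-1}{i}_q .$$ If equality holds, then $|\phi_A^{-1}(D)|\ge\binom{k-1}{i}_q$ for every $i$-dimensional subspace $D$ of $V$ skew to $A$, $\mathcal F^\star=\emptyset$, and $|\phi_A(B)|=q^{i(k-i)}$ for every $B\in\mathcal F_i\cup\mathcal F_{k-i}$. -/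

import Mathlib

open Module

namespace CoveringTriple

/-- The `q`-integer `[n]_q = 1 + q + ⋯ + q^(n-1)`. -/
def qInt (q n : ℕ) : ℕ := ∑ j ∈ Finset.range n, q ^ j

/-- The `q`-factorial `[n]_q! = [n]_q ⋯ [2]_q [1]_q`. -/
def qFactorial (q n : ℕ) : ℕ := ∏ j ∈ Finset.range n, qInt q (j + 1)

/-- The Gaussian binomial coefficient `[n]_q! / ([m]_q! [n-m]_q!)`, for `0 ≤ m ≤ n`
(it is only used in this range), as a rational number, so that the division is exact. -/
def gaussBinom (q n m : ℕ) : ℚ :=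
  (qFactorial q n : ℚ) / ((qFactorial q m : ℚ) * (qFactorial q (n - m) : ℚ))

variable {K V : Type*} [Field K] [AddCommGroup V] [Module K V]

/-- Three (distinct) subspaces `A`, `B`, `C` with `A = (A ∩ B) ⊕ (A ∩ C)`. -/
def IsCoveringTriple (A B C : Submodule K V) : Prop :=
  A ≠ B ∧ A ≠ C ∧ B ≠ C ∧ (A ⊓ B) ⊔ (A ⊓ C) = A ∧ (A ⊓ B) ⊓ (A ⊓ C) = ⊥

/-- No three distinct members of the family form a covering triple, in any order. -/
def CoveringTripleFree (F : Set (Submodule K V)) : Prop :=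
  ∀ A ∈ F, ∀ B ∈ F, ∀ C ∈ F, ¬ IsCoveringTriple A B C

/-- The members of `F` that are skew to every other member of `F`. -/
def starPart (F : Set (Submodule K V)) : Set (Submodule K V) :=
  {B | B ∈ F ∧ ∀ C ∈ F, C ≠ B → B ⊓ C = ⊥}

open Classical in
/-- The index `i_A(B)`, meaningful for `B ∈ F` outside `starPart F`: `dim (A ∩ B)` if
`A ∩ B ≠ 0`, and otherwise the least non-zero value of `dim (B ∩ C)` with `C ∈ F`. -/
noncomputable def index (F : Set (Submodule K V)) (A B : Submodule K V) : ℕ :=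
  if A ⊓ B ≠ ⊥ then finrank K ↥(A ⊓ B)
  else sInf {d : ℕ | ∃ C ∈ F, B ⊓ C ≠ ⊥ ∧ finrank K ↥(B ⊓ C) = d}

open Classical in
/-- The family `I_A(B)`, for `B ∈ F` outside `starPart F`: it is `{A}` if `A ∩ B ≠ 0`, and
otherwise consists of the `C ∈ F` with `dim (B ∩ C) = i_A(B)`. -/
noncomputable def indexFamily (F : Set (Submodule K V)) (A B : Submodule K V) :
    Set (Submodule K V) :=
  if A ⊓ B ≠ ⊥ then {A}
  else {C | C ∈ F ∧ finrank K ↥(B ⊓ C) = index F A B}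

open Classical in
/-- The set `φ_A(B)` of the subspaces claimed by `B ∈ F`, for a family of `k`-dimensional
subspaces: all subspaces of `B` if `B ∈ starPart F`, and otherwise the `(k - i_A(B))`-dimensional
subspaces of `B` that are skew to some member of `I_A(B)`. -/
noncomputable def claimed (k : ℕ) (F : Set (Submodule K V)) (A B : Submodule K V) :
    Set (Submodule K V) :=
  if B ∈ starPart F then {D | D ≤ B}
  else {D | D ≤ B ∧ finrank K D + index F A B = k ∧ ∃ C ∈ indexFamily F A B, D ⊓ C = ⊥}

/-- The set `φ_A⁻¹(D)` of the members of `F` that claim `D`. -/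
def claimants (k : ℕ) (F : Set (Submodule K V)) (A D : Submodule K V) :
    Set (Submodule K V) :=
  {B | B ∈ F ∧ D ∈ claimed k F A B}

/-- The subfamily `F_i = F_{i,A}`: the `B ∈ F` outside `starPart F` with `i_A(B) = i`, together
with all of `starPart F`. -/
def layer (F : Set (Submodule K V)) (A : Submodule K V) (i : ℕ) : Set (Submodule K V) :=
  {B | B ∈ F ∧ B ∉ starPart F ∧ index F A B = i} ∪ starPart F

end CoveringTriple

set_option linter.unusedSectionVars false

namespace CoveringTriple

/-! ### Identities and estimates for Gaussian binomials -/

section Numeric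

variable {q : ℕ}

/-! Write j = k - i and count pairs (D, B) where B claims a subspace D skew to A. A member B of F_i
outside the star part claims every complement in B of B ∩ C, for any C in I_A(B). So B claims at
least q^(ij) subspaces of dimension j, all skew to A; star members other than A claim more. Hence, A
aside, q^(ij)|F_i| is at most the sum of |φ_A⁻¹(D)| over the j-dimensional D skew to A. In the same
way F_j is controlled by the i-dimensional D. There are q^(kd) binom(n-k, d) subspaces of dimension
d skew to A, so the bound follows if the average number of claimants is under control.

Local bounds. If no star member contains D, all claimants X of D have traces X ∩ C of the same
dimension k - dim D on a single member C skew to D (`finrank_inf_eq_index`). Since X = D ⊕ (X ∩ C),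
the trace determines X. The absence of covering triples makes the traces of the claimants of a
j-dimensional D' pairwise intersecting, and makes them intersect the traces of the claimants of an
i-dimensional D ≤ D'. The first fact and Erdős–Ko–Rado give |φ_A⁻¹(D')| ≤ binom(k-1, i-1)
(`card_claimants_le`). Both facts together give |φ_A⁻¹(D)| + q^j |φ_A⁻¹(D')| ≤ binom(k, i) =
binom(k-1, i) + q^j binom(k-1, i-1) (`card_claimants_add_le`). The cross-intersecting inequality
behind this comes from averaging over a partial spread built from a field extension. Combined with a
Kruskal–Katona bound for subspaces it also yields Erdős–Ko–Rado.

Global bound. The second local bound is averaged over the biregular relation D ≤ D'. If i < j, there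
are at least 2q^j times as many D' as D, so a surplus at dimension i is at most half the deficit at
dimension j (`add_le_of_weighted`), and equality forces both sums to be maximal. If i = j, both sums
coincide and Erdős–Ko–Rado suffices.

If A lies in the star part, it belongs to both layers but claims nothing nonzero skew to itself, so
two units of slack are needed. Then every claimed D is claimed by all members of the relevant layer
containing it. A layer close to the bound would leave few D unclaimed, and counting containments
instead of claims gives a contradiction.

Many lemmas write i + 1 for the i of the theorem, j for k - i and m for n - k. -/

theorem qInt_zero : qInt q 0 = 0 := by simp [qInt]

theorem qInt_one : qInt q 1 = 1 := by simp [qInt]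

theorem qInt_succ (n : ℕ) : qInt q (n + 1) = qInt q n + q ^ n := by
  simp [qInt, Finset.sum_range_succ]

theorem qInt_add (a b : ℕ) : qInt q (a + b) = qInt q a + q ^ a * qInt q b := by
  induction b with
  | zero => simp [qInt_zero]
  | succ b ih => rw [← add_assoc, qInt_succ, ih, qInt_succ]; ring

theorem qInt_succ_pos (n : ℕ) : 0 < qInt q (n + 1) := by
  rw [add_comm, qInt_add, qInt_one]; positivity

theorem qInt_pos {n : ℕ} (hn : 1 ≤ n) : 0 < qInt q n := by
  obtain ⟨m, rfl⟩ := Nat.exists_eq_add_of_le' hn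
  exact qInt_succ_pos m

theorem mul_qInt (n : ℕ) : ((q : ℚ) - 1) * qInt q n = (q : ℚ) ^ n - 1 := by
  induction n with
  | zero => simp [qInt_zero]
  | succ n ih => rw [qInt_succ]; push_cast; rw [mul_add, ih]; ring

theorem qFactorial_zero : qFactorial q 0 = 1 := by simp [qFactorial]

theorem qFactorial_succ (n : ℕ) : qFactorial q (n + 1) = qFactorial q n * qInt q (n + 1) := by
  simp [qFactorial, Finset.prod_range_succ]

theorem qFactorial_pos (n : ℕ) : 0 < qFactorial q n :=
  Finset.prod_pos fun j _ => qInt_succ_pos j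

theorem gaussBinom_pos (m r : ℕ) : 0 < gaussBinom q m r := by
  have h1 := qFactorial_pos (q := q) m
  have h2 := qFactorial_pos (q := q) r
  have h3 := qFactorial_pos (q := q) (m - r)
  unfold gaussBinom
  positivity

theorem gaussBinom_add (a b : ℕ) : gaussBinom q (a + b) a =
    (qFactorial q (a + b) : ℚ) / ((qFactorial q a : ℚ) * (qFactorial q b : ℚ)) := by
  unfold gaussBinom; rw [Nat.add_sub_cancel_left]

theorem gaussBinom_symm {m r : ℕ} (h : r ≤ m) : gaussBinom q m (m - r) = gaussBinom q m r := by
  unfold gaussBinom; rw [Nat.sub_sub_self h, mul_comm]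

theorem gaussBinom_zero (m : ℕ) : gaussBinom q m 0 = 1 := by
  have h1 := qFactorial_pos (q := q) m
  unfold gaussBinom; rw [qFactorial_zero, Nat.sub_zero]; field_simp; simp

theorem gaussBinom_self (m : ℕ) : gaussBinom q m m = 1 := by
  have := gaussBinom_symm (q := q) (Nat.zero_le m)
  rwa [gaussBinom_zero, Nat.sub_zero] at this

theorem gaussBinom_pascal (a b : ℕ) : gaussBinom q (a + b + 2) (a + 1) =
    (q : ℚ) ^ (a + 1) * gaussBinom q (a + b + 1) (a + 1) + gaussBinom q (a + b + 1) a := by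
  have e1 : a + b + 2 = (a + 1) + (b + 1) := by ring
  have e2 : gaussBinom q (a + b + 1) (a + 1) = gaussBinom q ((a + 1) + b) (a + 1) := by
    congr 1; ring
  rw [e1, e2, show a + b + 1 = a + (b + 1) by ring, gaussBinom_add, gaussBinom_add, gaussBinom_add]
  have ha := qFactorial_pos (q := q) a
  have hb := qFactorial_pos (q := q) b
  have ha' := qInt_succ_pos (q := q) a
  have hb' := qInt_succ_pos (q := q) b
  rw [show (a + 1) + (b + 1) = (a + (b + 1)) + 1 by ring, show a + 1 + b = a + (b + 1) by ring,
    qFactorial_succ (a + (b + 1)), qFactorial_succ a, qFactorial_succ b,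
    show a + (b + 1) + 1 = (a + 1) + (b + 1) by ring, qInt_add (a + 1)]
  push_cast
  field_simp
  ring

theorem gaussBinom_pascal' (a b : ℕ) : gaussBinom q (a + b + 2) (a + 1) =
    gaussBinom q (a + b + 1) (a + 1) + (q : ℚ) ^ (b + 1) * gaussBinom q (a + b + 1) a := by
  have h := gaussBinom_pascal (q := q) b a
  rw [← gaussBinom_symm (by omega), ← gaussBinom_symm (r := a + 1) (by omega),
    ← gaussBinom_symm (r := a) (by omega), show a + b + 2 - (a + 1) = b + 1 by omega,
    show a + b + 1 - (a + 1) = b by omega, show a + b + 1 - a = b + 1 by omega, add_comm a b, h]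
  ring

theorem gaussBinom_absorb {m r : ℕ} (h : r ≤ m) :
    (qInt q (r + 1) : ℚ) * gaussBinom q (m + 1) (r + 1) = qInt q (m + 1) * gaussBinom q m r := by
  obtain ⟨b, rfl⟩ := Nat.exists_eq_add_of_le h
  rw [show r + b + 1 = (r + 1) + b by ring, gaussBinom_add, gaussBinom_add,
    show (r + 1) + b = r + b + 1 by ring, qFactorial_succ, qFactorial_succ]
  have ha := qFactorial_pos (q := q) r
  have hb := qFactorial_pos (q := q) b
  have ha' := qInt_succ_pos (q := q) r
  push_cast
  field_simp

theorem gaussBinom_one (m : ℕ) : gaussBinom q (m + 1) 1 = qInt q (m + 1) := by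
  have := gaussBinom_absorb (q := q) (Nat.zero_le m)
  simpa [qInt_one, gaussBinom_zero] using this

theorem gaussBinom_pred (m : ℕ) : gaussBinom q (m + 1) m = qInt q (m + 1) := by
  rw [← gaussBinom_one, ← gaussBinom_symm (by omega)]; simp

theorem pow_le_gaussBinom (a b : ℕ) : (q : ℚ) ^ (a * b) ≤ gaussBinom q (a + b) a := by
  induction b with
  | zero => simp [gaussBinom_self]
  | succ b ih =>
    cases a with
    | zero => simp [gaussBinom_zero]
    | succ a =>
      have h := gaussBinom_pascal (q := q) a b
      rw [show a + 1 + (b + 1) = a + b + 2 by ring, h]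
      have h2 := gaussBinom_pos (q := q) (a + b + 1) a
      rw [show a + 1 + b = a + b + 1 by ring] at ih
      have h3 := mul_le_mul_of_nonneg_left ih (by positivity : (0 : ℚ) ≤ (q : ℚ) ^ (a + 1))
      rw [← pow_add] at h3
      rw [show (a + 1) * (b + 1) = a + 1 + (a + 1) * b by ring]
      linarith

/-- Keeping the second leading term gives the strict gain over q^((a+1)(b+1)) that excludes star
members at equality and drives the estimate for isolated A. -/
theorem pow_add_pow_le_gaussBinom (a b : ℕ) :
    (q : ℚ) ^ ((a + 1) * (b + 1)) + (q : ℚ) ^ ((a + 1) * (b + 1) - 1)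
      ≤ gaussBinom q (a + b + 2) (a + 1) := by
  induction b with
  | zero =>
    rw [gaussBinom_pred (a + 0 + 1), qInt_succ, qInt_succ]
    have : (0 : ℚ) ≤ qInt q a := by positivity
    simp
    linarith
  | succ b ih =>
    have h := gaussBinom_pascal (q := q) a (b + 1)
    rw [h]
    have h2 := gaussBinom_pos (q := q) (a + (b + 1) + 1) a
    have h3 := mul_le_mul_of_nonneg_left ih (by positivity : (0 : ℚ) ≤ (q : ℚ) ^ (a + 1))
    rw [mul_add, ← pow_add, ← pow_add] at h3
    rw [show (a + 1) * (b + 1 + 1) = a + 1 + (a + 1) * (b + 1) by ring,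
      Nat.add_sub_assoc (by nlinarith)]
    rw [show a + (b + 1) + 1 = a + b + 2 by ring] at *
    linarith

theorem one_le_gaussBinom (hq : 1 ≤ q) {m r : ℕ} (h : r ≤ m) : 1 ≤ gaussBinom q m r := by
  obtain ⟨b, rfl⟩ := Nat.exists_eq_add_of_le h
  refine le_trans ?_ (pow_le_gaussBinom r b)
  exact one_le_pow₀ (by exact_mod_cast hq)

/-- Iterating the first summand of Pascal's rule, with one second summand kept. -/
theorem pow_mul_gaussBinom_add_one_le (hq : 1 ≤ q) (i c j : ℕ) :
    (q : ℚ) ^ ((i + 1) * (j + 1)) * gaussBinom q (i + 1 + c) (i + 1) + 1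
      ≤ gaussBinom q (i + 1 + c + (j + 1)) (i + 1) := by
  have hq' : (1 : ℚ) ≤ q := by exact_mod_cast hq
  induction j with
  | zero =>
    have h := gaussBinom_pascal (q := q) i c
    rw [show i + 1 + c + (0 + 1) = i + c + 2 by ring, h, show i + 1 + c = i + c + 1 by ring]
    have := one_le_gaussBinom hq (show i ≤ i + c + 1 by omega)
    simpa using this
  | succ j ih =>
    have h := gaussBinom_pascal (q := q) i (c + j + 1)
    rw [show i + 1 + c + (j + 1 + 1) = i + (c + j + 1) + 2 by ring, h]
    rw [show i + 1 + c + (j + 1) = i + (c + j + 1) + 1 by ring] at ih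
    have h1 := one_le_gaussBinom hq (show i ≤ i + (c + j + 1) + 1 by omega)
    have hp : (0 : ℚ) ≤ (q : ℚ) ^ (i + 1) := by positivity
    have h3 := mul_le_mul_of_nonneg_left ih hp
    rw [show (i + 1) * (j + 1 + 1) = (i + 1) + (i + 1) * (j + 1) by ring, pow_add]
    nlinarith

theorem prod_pow_sub_pow (m r : ℕ) (h : r ≤ m) :
    (∏ i : Fin r, ((q : ℚ) ^ m - (q : ℚ) ^ (i : ℕ))) * qFactorial q (m - r) =
      (∏ i : Fin r, (q : ℚ) ^ (i : ℕ)) * ((q : ℚ) - 1) ^ r * qFactorial q m := by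
  induction r with
  | zero => simp
  | succ r ih =>
    have ih := ih (by omega)
    rw [Fin.prod_univ_castSucc, Fin.prod_univ_castSucc]
    simp only [Fin.val_castSucc, Fin.val_last]
    obtain ⟨b, rfl⟩ := Nat.exists_eq_add_of_le h
    rw [show r + 1 + b - r = b + 1 by omega, qFactorial_succ] at ih
    rw [show r + 1 + b - (r + 1) = b by omega]
    have hm := mul_qInt (q := q) (b + 1)
    have e : (q : ℚ) ^ (r + 1 + b) - (q : ℚ) ^ r = q ^ r * (((q : ℚ) - 1) * qInt q (b + 1)) := by
      rw [hm]; ring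
    rw [e]
    push_cast at ih ⊢
    rw [pow_succ]
    linear_combination (q : ℚ) ^ r * ((q : ℚ) - 1) * ih

/-- This links the factorial formula to counts of ordered independent tuples: the products count
r-tuples in dimensions r and m. -/
theorem gaussBinom_mul_prod (m r : ℕ) (h : r ≤ m) :
    gaussBinom q m r * (∏ i : Fin r, ((q : ℚ) ^ r - (q : ℚ) ^ (i : ℕ))) =
      ∏ i : Fin r, ((q : ℚ) ^ m - (q : ℚ) ^ (i : ℕ)) := by
  have h1 := prod_pow_sub_pow (q := q) m r h
  have h2 := prod_pow_sub_pow (q := q) r r le_rfl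
  rw [Nat.sub_self, qFactorial_zero, Nat.cast_one, mul_one] at h2
  have hr := qFactorial_pos (q := q) r
  have hmr := qFactorial_pos (q := q) (m - r)
  rw [h2, gaussBinom]
  field_simp
  linear_combination -h1

end Numeric

/-! ### Counting subspaces through independent families -/

section Counting

variable {K V : Type*} [Field K] [Finite K] [AddCommGroup V] [Module K V] [FiniteDimensional K V]

theorem linearIndependent_mkQ_iff (A : Submodule K V) {r : ℕ} (s : Fin (r + 1) → V) :
    LinearIndependent K (A.mkQ ∘ s) ↔ LinearIndependent K (A.mkQ ∘ Fin.init s) ∧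
      s (Fin.last r) ∉ A ⊔ Submodule.span K (Set.range (Fin.init s)) := by
  have e : Fin.init (A.mkQ ∘ s) = A.mkQ ∘ Fin.init s := rfl
  rw [linearIndependent_finSucc', e, Set.range_comp, ← Submodule.map_span,
    ← Submodule.comap_map_mkQ]
  rfl

theorem finrank_sup_span_of_linearIndependent_mkQ (A : Submodule K V) {r : ℕ} {s : Fin r → V}
    (hs : LinearIndependent K (A.mkQ ∘ s)) :
    finrank K ↥(A ⊔ Submodule.span K (Set.range s)) = finrank K A + r := by
  have hd := Submodule.range_ker_disjoint hs
  rw [Submodule.ker_mkQ] at hd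
  have h := Submodule.finrank_sup_add_finrank_inf_eq A (Submodule.span K (Set.range s))
  rw [hd.symm.eq_bot, finrank_bot, finrank_span_eq_card (LinearIndependent.of_comp _ hs),
    Fintype.card_fin] at h
  exact h

theorem natCard_mem_notMem {X T : Submodule K V} (h : X ≤ T) :
    Nat.card {v : V // v ∈ T ∧ v ∉ X} = Nat.card K ^ finrank K T - Nat.card K ^ finrank K X := by
  have : Finite V := Module.finite_of_finite K
  have e := Set.ncard_sdiff (s := (X : Set V)) (t := (T : Set V)) h (Set.toFinite _)
  rw [← natCard_eq_pow_finrank, ← natCard_eq_pow_finrank]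
  exact e

/-- The families of `r` vectors of `T` that are linearly independent modulo `A`. -/
abbrev IndepFamily (A T : Submodule K V) (r : ℕ) : Type _ :=
  {s : Fin r → V // (∀ j, s j ∈ T) ∧ LinearIndependent K (A.mkQ ∘ s)}

/-- Splitting off the last vector of an independent family. -/
def indepFamilyEquiv (A T : Submodule K V) (r : ℕ) : IndepFamily A T (r + 1) ≃
    Σ s : IndepFamily A T r,
      {v : V // v ∈ T ∧ v ∉ A ⊔ Submodule.span K (Set.range s.1)} where
  toFun s := ⟨⟨Fin.init s.1, fun j => s.2.1 _, ((linearIndependent_mkQ_iff A s.1).1 s.2.2).1⟩,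
    ⟨s.1 (Fin.last r), s.2.1 _, ((linearIndependent_mkQ_iff A s.1).1 s.2.2).2⟩⟩
  invFun p := ⟨Fin.snoc p.1.1 p.2.1, fun j => by
      refine Fin.lastCases ?_ (fun j => ?_) j
      · simpa using p.2.2.1
      · simpa using p.1.2.1 j, by
      rw [linearIndependent_mkQ_iff]
      simpa using ⟨p.1.2.2, p.2.2.2⟩⟩
  left_inv s := by simp
  right_inv p := by
    rcases p with ⟨⟨s, hs⟩, ⟨v, hv⟩⟩
    simp only [Fin.snoc_last, Sigma.mk.injEq, Fin.init_snoc, true_and]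
    congr 1
    all_goals simp

theorem natCard_indepFamily {A T : Submodule K V} (hAT : A ≤ T) (r : ℕ)
    (hr : finrank K A + r ≤ finrank K T) :
    (Nat.card (IndepFamily A T r) : ℚ) =
      ∏ i : Fin r, ((Nat.card K : ℚ) ^ finrank K T - (Nat.card K : ℚ) ^ (finrank K A + i)) := by
  have hV : Finite V := Module.finite_of_finite K
  induction r with
  | zero =>
    have : Unique (IndepFamily A T 0) :=
      { default := ⟨Fin.elim0, fun j => j.elim0, linearIndependent_empty_type⟩
        uniq := fun s => Subtype.ext (Subsingleton.elim _ _) }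
    simp
  | succ r ih =>
    have : Fintype (IndepFamily A T r) := Fintype.ofFinite _
    have hfib (s : IndepFamily A T r) :
        (Nat.card {v : V // v ∈ T ∧ v ∉ A ⊔ Submodule.span K (Set.range s.1)} : ℚ) =
          (Nat.card K : ℚ) ^ finrank K T - (Nat.card K : ℚ) ^ (finrank K A + r) := by
      have hle : A ⊔ Submodule.span K (Set.range s.1) ≤ T := by
        refine sup_le hAT (Submodule.span_le.2 ?_)
        rintro _ ⟨j, rfl⟩
        exact s.2.1 j
      rw [natCard_mem_notMem hle, finrank_sup_span_of_linearIndependent_mkQ A s.2.2, Nat.cast_sub]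
      · push_cast; rfl
      · exact Nat.pow_le_pow_right Nat.card_pos (by omega)
    rw [Nat.card_congr (indepFamilyEquiv A T r), Nat.card_sigma]
    push_cast
    rw [Finset.sum_congr rfl fun s _ => hfib s, Finset.sum_const, Finset.card_univ,
      ← Nat.card_eq_fintype_card, nsmul_eq_mul, ih (by omega), Fin.prod_univ_castSucc]
    simp

/-- The quotient Y/X embeds in V/A, because Y meets A exactly in X. -/
theorem indep_mkQ_of_inf_eq {X A Y : Submodule K V} (hXA : X ≤ A) (hYA : Y ⊓ A = X) {r : ℕ}
    {s : Fin r → V} (hs : ∀ j, s j ∈ Y) :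
    LinearIndependent K (A.mkQ ∘ s) ↔ LinearIndependent K (X.mkQ ∘ s) := by
  have hf : A.mkQ ∘ s = Submodule.factor hXA ∘ (X.mkQ ∘ s) := by
    ext j; simp
  constructor
  · intro h
    rw [hf] at h
    exact LinearIndependent.of_comp _ h
  · intro h
    rw [hf]
    refine (LinearMap.linearIndependent_iff_of_disjoint _ ?_).2 h
    rw [Set.range_comp, ← Submodule.map_span, Submodule.disjoint_def]
    rintro _ ⟨v, hv, rfl⟩ hker
    have hvY : v ∈ Y := by
      refine (Submodule.span_le.2 ?_ : Submodule.span K (Set.range s) ≤ Y) hv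
      rintro _ ⟨j, rfl⟩
      exact hs j
    have hvA : v ∈ A := by simpa using hker
    rw [Submodule.mkQ_apply, Submodule.Quotient.mk_eq_zero, ← hYA]
    exact ⟨hvY, hvA⟩

theorem one_lt_natCard : 2 ≤ Nat.card K := Finite.one_lt_card

/-- The number of subspaces `Y` of dimension `dim X + r` between `X` and `T` with `Y ∩ A = X`. -/
theorem ncard_inf_eq {X A T : Submodule K V} (hXA : X ≤ A) (hAT : A ≤ T) {x e m r : ℕ}
    (hX : finrank K X = x) (hA : finrank K A = x + e) (hT : finrank K T = x + e + m)
    (hr : r ≤ m) :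
    ({Y : Submodule K V | X ≤ Y ∧ Y ≤ T ∧ Y ⊓ A = X ∧ finrank K Y = x + r}.ncard : ℚ) =
      (Nat.card K : ℚ) ^ (e * r) * gaussBinom (Nat.card K) m r := by
  have hV : Finite V := Module.finite_of_finite K
  set q := Nat.card K with hq
  have hq2 : 2 ≤ q := one_lt_natCard
  set S := {Y : Submodule K V | X ≤ Y ∧ Y ≤ T ∧ Y ⊓ A = X ∧ finrank K Y = x + r} with hS
  have hmem (s : IndepFamily A T r) : X ⊔ Submodule.span K (Set.range s.1) ∈ S := by
    have hd := Submodule.range_ker_disjoint s.2.2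
    rw [Submodule.ker_mkQ] at hd
    have hX' : LinearIndependent K (X.mkQ ∘ s.1) := by
      have hf : A.mkQ ∘ s.1 = Submodule.factor hXA ∘ (X.mkQ ∘ s.1) := by
        ext j; simp
      have h := s.2.2
      rw [hf] at h
      exact LinearIndependent.of_comp _ h
    refine ⟨le_sup_left, sup_le (hXA.trans hAT) (Submodule.span_le.2 ?_), ?_, ?_⟩
    · rintro _ ⟨j, rfl⟩
      exact s.2.1 j
    · rw [sup_inf_assoc_of_le _ hXA, hd.eq_bot, sup_bot_eq]
    · rw [finrank_sup_span_of_linearIndependent_mkQ X hX', hX]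
  let φ : IndepFamily A T r → S := fun s => ⟨_, hmem s⟩
  -- The tuples that span a given Y together with X are the bases of Y modulo X, so all fibres have
  -- the same size and the count is a quotient.
  have hfib (Y : S) : Nat.card {s // φ s = Y} = Nat.card (IndepFamily X Y.1 r) := by
    obtain ⟨Y, hXY, hYT, hYA, hYr⟩ := Y
    refine Nat.card_congr
      { toFun := fun s => ⟨s.1.1, fun j => ?_, ?_⟩
        invFun := fun s => ⟨⟨s.1, fun j => hYT (s.2.1 j),
          (indep_mkQ_of_inf_eq hXA hYA s.2.1).2 s.2.2⟩, ?_⟩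
        left_inv := fun s => rfl
        right_inv := fun s => rfl }
    · have h1 : X ⊔ Submodule.span K (Set.range s.1.1) = Y := congrArg Subtype.val s.2
      exact h1.le (Submodule.mem_sup_right (Submodule.subset_span ⟨j, rfl⟩))
    · have h1 : X ⊔ Submodule.span K (Set.range s.1.1) = Y := congrArg Subtype.val s.2
      refine (indep_mkQ_of_inf_eq hXA hYA fun j => ?_).1 s.1.2.2
      exact h1.le (Submodule.mem_sup_right (Submodule.subset_span ⟨j, rfl⟩))
    · refine Subtype.ext (Submodule.eq_of_le_of_finrank_eq ?_ ?_)
      · refine sup_le hXY (Submodule.span_le.2 ?_)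
        rintro _ ⟨j, rfl⟩
        exact s.2.1 j
      · rw [finrank_sup_span_of_linearIndependent_mkQ X s.2.2, hX, hYr]
  have hSf : Fintype S := Fintype.ofFinite _
  have htot := Nat.card_congr (Equiv.sigmaFiberEquiv φ)
  rw [Nat.card_sigma, Finset.sum_congr rfl fun Y _ => hfib Y] at htot
  have htot' : (∑ Y : S, (Nat.card (IndepFamily X Y.1 r) : ℚ)) = Nat.card (IndepFamily A T r) := by
    exact_mod_cast htot
  have hY (Y : S) : (Nat.card (IndepFamily X Y.1 r) : ℚ) =
      (q : ℚ) ^ (x * r) * ∏ i : Fin r, ((q : ℚ) ^ r - (q : ℚ) ^ (i : ℕ)) := by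
    rw [natCard_indepFamily Y.2.1 r (by rw [hX, Y.2.2.2.2]), hX, Y.2.2.2.2, pow_mul,
      ← Fin.prod_const r ((q : ℚ) ^ x), ← Finset.prod_mul_distrib]
    exact Finset.prod_congr rfl fun i _ => by rw [← hq]; ring
  have hT' : (Nat.card (IndepFamily A T r) : ℚ) =
      (q : ℚ) ^ ((x + e) * r) * ∏ i : Fin r, ((q : ℚ) ^ m - (q : ℚ) ^ (i : ℕ)) := by
    rw [natCard_indepFamily hAT r (by omega), hA, hT, pow_mul,
      ← Fin.prod_const r ((q : ℚ) ^ (x + e)), ← Finset.prod_mul_distrib]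
    exact Finset.prod_congr rfl fun i _ => by rw [← hq]; ring
  rw [Finset.sum_congr rfl fun Y _ => hY Y, hT', Finset.sum_const, Finset.card_univ,
    ← Nat.card_eq_fintype_card, Nat.card_coe_set_eq, nsmul_eq_mul,
    ← gaussBinom_mul_prod m r hr] at htot'
  have hpos : 0 < ∏ i : Fin r, ((q : ℚ) ^ r - (q : ℚ) ^ (i : ℕ)) := by
    refine Finset.prod_pos fun i _ => sub_pos.2 (pow_lt_pow_right₀ ?_ i.2)
    exact_mod_cast hq2
  have hqx : (0 : ℚ) < (q : ℚ) ^ (x * r) := by positivity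
  have key : (q : ℚ) ^ (x * r) * ∏ i : Fin r, ((q : ℚ) ^ r - (q : ℚ) ^ (i : ℕ)) ≠ 0 := by
    positivity
  apply mul_right_cancel₀ key
  rw [htot', add_mul, pow_add]
  ring

end Counting

/-! ### A Kruskal–Katona bound for upper shadows -/

section Shadow

variable {K V : Type*} [Field K] [Finite K] [AddCommGroup V] [Module K V] [FiniteDimensional K V]
  [Fintype (Submodule K V)]

open Classical

theorem card_inf_eq {X A T : Submodule K V} (hXA : X ≤ A) (hAT : A ≤ T) {x e m r : ℕ}
    (hX : finrank K X = x) (hA : finrank K A = x + e) (hT : finrank K T = x + e + m)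
    (hr : r ≤ m) :
    ((Finset.univ.filter fun Y : Submodule K V =>
      X ≤ Y ∧ Y ≤ T ∧ Y ⊓ A = X ∧ finrank K Y = x + r).card : ℚ) =
      (Nat.card K : ℚ) ^ (e * r) * gaussBinom (Nat.card K) m r := by
  rw [← ncard_inf_eq hXA hAT hX hA hT hr, ← Set.ncard_coe_finset]
  simp

theorem card_between {X T : Submodule K V} (hXT : X ≤ T) {x m r : ℕ}
    (hX : finrank K X = x) (hT : finrank K T = x + m) (hr : r ≤ m) :
    ((Finset.univ.filter fun Y : Submodule K V =>
      X ≤ Y ∧ Y ≤ T ∧ finrank K Y = x + r).card : ℚ) = gaussBinom (Nat.card K) m r := by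
  have h := card_inf_eq (e := 0) le_rfl hXT hX (by simpa using hX) (by simpa using hT) hr
  rw [zero_mul, pow_zero, one_mul] at h
  rw [← h]
  congr 2
  ext Y
  simp only [Finset.mem_filter, Finset.mem_univ, true_and]
  constructor
  · rintro ⟨h1, h2, h3⟩
    exact ⟨h1, h2, inf_eq_right.2 h1, h3⟩
  · rintro ⟨h1, h2, -, h3⟩
    exact ⟨h1, h2, h3⟩

theorem card_hyperplanes {X T : Submodule K V} (hXT : X ≤ T) {s : ℕ}
    (h : finrank K X + (s + 1) = finrank K T) :
    (Finset.univ.filter fun H : Submodule K V =>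
      X ≤ H ∧ H ≤ T ∧ finrank K H + 1 = finrank K T).card = qInt (Nat.card K) (s + 1) := by
  have h1 := card_between (r := s) hXT rfl h.symm (by omega)
  rw [gaussBinom_pred] at h1
  rw [← Nat.cast_inj (R := ℚ), ← h1]
  congr 2
  ext H
  simp only [Finset.mem_filter, Finset.mem_univ, true_and]
  refine and_congr_right fun _ => and_congr_right fun _ => ?_
  omega

/-- The subspaces of `T` of codimension `r + 1` all of whose covers in `T` belong to `S`. -/
noncomputable def fullCover (T : Submodule K V) (S : Finset (Submodule K V)) (r : ℕ) :
    Finset (Submodule K V) :=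
  Finset.univ.filter fun X => X ≤ T ∧ finrank K X + (r + 1) = finrank K T ∧
    ∀ Y, X ≤ Y → Y ≤ T → finrank K Y + r = finrank K T → Y ∈ S

theorem mem_fullCover {T : Submodule K V} {S : Finset (Submodule K V)} {r : ℕ}
    {X : Submodule K V} : X ∈ fullCover T S r ↔ X ≤ T ∧ finrank K X + (r + 1) = finrank K T ∧
    ∀ Y, X ≤ Y → Y ≤ T → finrank K Y + r = finrank K T → Y ∈ S := by
  simp [fullCover]

/-- Such an X in the hyperplane H has q^(r+1) covers in T outside H, all in S, and a cover Y outside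
H recovers X as Y ∩ H. -/
theorem pow_mul_card_fullCover_le {T H : Submodule K V} {S : Finset (Submodule K V)} {r : ℕ}
    (hHT : H ≤ T) (hH : finrank K H + 1 = finrank K T) :
    Nat.card K ^ (r + 1) * ((fullCover T S (r + 1)).filter (· ≤ H)).card +
      (S.filter (· ≤ H)).card ≤ S.card := by
  have key := Finset.card_mul_le_card_mul (fun X Y : Submodule K V => Y ⊓ H = X)
    (s := (fullCover T S (r + 1)).filter (· ≤ H)) (t := S.filter fun Y => ¬ Y ≤ H)
    (m := Nat.card K ^ (r + 1)) (n := 1) ?_ ?_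
  · have := Finset.card_filter_add_card_filter_not (s := S) (· ≤ H)
    rw [mul_comm] at key
    omega
  · intro X hX
    rw [Finset.mem_filter, mem_fullCover] at hX
    obtain ⟨⟨hXT, hXr, hXS⟩, hXH⟩ := hX
    have h := card_inf_eq (x := finrank K X) (e := r + 1) (m := 1) (r := 1) hXH hHT rfl
      (by omega) (by omega) le_rfl
    rw [gaussBinom_self, mul_one, mul_one] at h
    have h' := (Nat.cast_inj (R := ℚ)).1 (h.trans (Nat.cast_pow _ _).symm)
    rw [← h']
    refine Finset.card_le_card fun Y hY => ?_
    simp only [Finset.mem_filter, Finset.mem_univ, true_and] at hY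
    obtain ⟨hXY, hYT, hYH, hYr⟩ := hY
    rw [Finset.mem_bipartiteAbove, Finset.mem_filter]
    refine ⟨⟨hXS Y hXY hYT (by omega), fun hle => ?_⟩, hYH⟩
    rw [inf_eq_left.2 hle] at hYH
    rw [hYH] at hYr
    omega
  · intro Y _
    rw [Finset.card_le_one]
    intro X hX X' hX'
    rw [Finset.mem_bipartiteBelow] at hX hX'
    exact hX.2.symm.trans hX'.2

theorem sum_card_hyperplanes {T : Submodule K V} {P : Finset (Submodule K V)} {s : ℕ}
    (hP : ∀ X ∈ P, X ≤ T ∧ finrank K X + (s + 1) = finrank K T) :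
    ∑ H ∈ Finset.univ.filter (fun H : Submodule K V => H ≤ T ∧ finrank K H + 1 = finrank K T),
      (P.filter (· ≤ H)).card = P.card * qInt (Nat.card K) (s + 1) := by
  have h := Finset.sum_card_bipartiteAbove_eq_sum_card_bipartiteBelow
    (fun X H : Submodule K V => X ≤ H) (s := P)
    (t := Finset.univ.filter (fun H : Submodule K V => H ≤ T ∧ finrank K H + 1 = finrank K T))
  unfold Finset.bipartiteBelow at h
  rw [← h, Finset.sum_const_nat]
  intro X hX
  rw [← card_hyperplanes (hP X hX).1 (hP X hX).2]
  congr 1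
  ext H
  simp only [Finset.mem_bipartiteAbove, Finset.mem_filter, Finset.mem_univ, true_and]
  tauto

/-- A linear form of the Kruskal–Katona theorem for subspaces, in terms of upper covers. -/
theorem card_fullCover_mul_le (c r : ℕ) : ∀ (T : Submodule K V) (S : Finset (Submodule K V)),
    (∀ Y ∈ S, Y ≤ T ∧ finrank K Y + r = finrank K T) →
    (S.card : ℚ) < gaussBinom (Nat.card K) (r + c) r →
    (fullCover T S r).card * qInt (Nat.card K) (r + 1) ≤ S.card * qInt (Nat.card K) c := by
  induction r with
  | zero =>
    intro T S _ hlt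
    rw [gaussBinom_zero] at hlt
    have hS : S = ∅ := by
      rw [← Finset.card_eq_zero]
      exact_mod_cast Nat.lt_one_iff.1 (by exact_mod_cast hlt)
    have hJ : fullCover T S 0 = ∅ := by
      rw [Finset.eq_empty_iff_forall_notMem]
      intro X hX
      rw [mem_fullCover] at hX
      simpa [hS] using hX.2.2 T hX.1 le_rfl rfl
    simp [hJ]
  | succ r ih =>
    intro T S hS hlt
    set q := Nat.card K with hq
    have hH (H) (hH : H ∈ Finset.univ.filter
        (fun H : Submodule K V => H ≤ T ∧ finrank K H + 1 = finrank K T)) :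
        ((fullCover T S (r + 1)).filter (· ≤ H)).card * qInt q (r + 1) ≤
          (S.filter (· ≤ H)).card * qInt q c := by
      simp only [Finset.mem_filter, Finset.mem_univ, true_and] at hH
      obtain ⟨hHT, hHr⟩ := hH
      -- Within a hyperplane, a small part of S is handled by induction. A large part leaves few
      -- members of S outside H, which bounds the full covers inside H directly.
      rcases lt_or_ge ((S.filter (· ≤ H)).card : ℚ) (gaussBinom q (r + c) r) with hd | hd
      · refine le_trans (Nat.mul_le_mul_right _ (Finset.card_le_card ?_))
          (ih H (S.filter (· ≤ H)) ?_ hd)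
        · intro X hX
          rw [Finset.mem_filter, mem_fullCover] at hX
          obtain ⟨⟨hXT, hXr, hXS⟩, hXH⟩ := hX
          rw [mem_fullCover]
          exact ⟨hXH, by omega, fun Y hXY hYH hYr =>
            Finset.mem_filter.2 ⟨hXS Y hXY (hYH.trans hHT) (by omega), hYH⟩⟩
        · intro Y hY
          rw [Finset.mem_filter] at hY
          have := (hS Y hY.1).2
          exact ⟨hY.2, by omega⟩
      · have h1 := pow_mul_card_fullCover_le (S := S) (r := r) hHT hHr
        have h1' : (q : ℚ) ^ (r + 1) * ((fullCover T S (r + 1)).filter (· ≤ H)).card +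
            (S.filter (· ≤ H)).card ≤ S.card := by exact_mod_cast h1
        have h2 := gaussBinom_absorb (q := q) (show r ≤ r + c by omega)
        have h3 : (qInt q (r + c + 1) : ℚ) = qInt q (r + 1) + q ^ (r + 1) * qInt q c := by
          rw [show r + c + 1 = r + 1 + c by ring, qInt_add]; push_cast; ring
        have hr0 : (0 : ℚ) < qInt q (r + 1) := by exact_mod_cast qInt_succ_pos r
        have hq0 : (0 : ℚ) < (q : ℚ) ^ (r + 1) := by
          have : 0 < q := Nat.card_pos
          positivity
        rw [show r + 1 + c = r + c + 1 by ring] at hlt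
        rw [← Nat.cast_le (α := ℚ)]
        push_cast
        have h4 := mul_lt_mul_of_pos_left hlt hr0
        rw [h2] at h4
        have h5 := mul_le_mul_of_nonneg_left hd (by positivity : (0 : ℚ) ≤ qInt q (r + c + 1))
        have h6 := mul_le_mul_of_nonneg_left h1' hr0.le
        refine le_of_mul_le_mul_left (a := (q : ℚ) ^ (r + 1)) ?_ hq0
        rw [h3] at h4 h5
        nlinarith
    -- Summing over hyperplanes, each X counts [r+2] times and each Y counts [r+1] times; the factor
    -- [r+1] then cancels.
    have hsum := Finset.sum_le_sum hH
    rw [← Finset.sum_mul, ← Finset.sum_mul, sum_card_hyperplanes hS,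
      sum_card_hyperplanes (s := r + 1) (fun X hX => by
        rw [mem_fullCover] at hX; exact ⟨hX.1, hX.2.1⟩)] at hsum
    refine Nat.le_of_mul_le_mul_right ?_ (qInt_succ_pos (q := q) r)
    rw [← hq] at hsum
    calc _ = _ := rfl
      _ ≤ _ := hsum
      _ = _ := by ring

/-- The subspaces of dimension `j` that contain a member of `G`. -/
noncomputable def upShadow (G : Finset (Submodule K V)) (j : ℕ) : Finset (Submodule K V) :=
  Finset.univ.filter fun Y => finrank K Y = j ∧ ∃ U ∈ G, U ≤ Y

theorem mem_upShadow {G : Finset (Submodule K V)} {j : ℕ} {Y : Submodule K V} :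
    Y ∈ upShadow G j ↔ finrank K Y = j ∧ ∃ U ∈ G, U ≤ Y := by
  simp [upShadow]

/-- One level at a time: the shadow at one level lies in the full cover of the next shadow, so if
the next shadow were too small, `card_fullCover_mul_le` would make the present one too small as
well. -/
theorem gaussBinom_le_card_upShadow {G : Finset (Submodule K V)} {i k : ℕ}
    (hV : finrank K V = k + 1) (hG : ∀ U ∈ G, finrank K U = i + 1)
    (hcard : gaussBinom (Nat.card K) k i ≤ G.card) (j : ℕ) (hij : i ≤ j) (hjk : j ≤ k) :
    gaussBinom (Nat.card K) k j ≤ (upShadow G (j + 1)).card := by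
  induction j, hij using Nat.le_induction with
  | base =>
    refine hcard.trans (Nat.cast_le.2 (Finset.card_le_card fun U hU => ?_))
    exact mem_upShadow.2 ⟨hG U hU, U, hU, le_rfl⟩
  | succ j hij ih =>
    have ih := ih (by omega)
    by_contra hlt
    rw [not_le] at hlt
    obtain ⟨r, rfl⟩ := Nat.exists_eq_add_of_le hjk
    set q := Nat.card K with hq
    have h := card_fullCover_mul_le (K := K) (V := V) (j + 1) r ⊤ (upShadow G (j + 1 + 1))
      (fun Y hY => ⟨le_top, by rw [(mem_upShadow.1 hY).1, finrank_top, hV]; ring⟩)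
      (by
        rw [← gaussBinom_symm (by omega), show r + (j + 1) - r = j + 1 by omega, add_comm r]
        exact hlt)
    have hsub : upShadow G (j + 1) ⊆ fullCover ⊤ (upShadow G (j + 1 + 1)) r := by
      intro Y hY
      obtain ⟨hYj, U, hU, hUY⟩ := mem_upShadow.1 hY
      rw [mem_fullCover, finrank_top, hV]
      refine ⟨le_top, by omega, fun Z hYZ _ hZ => mem_upShadow.2 ⟨by omega, U, hU, hUY.trans hYZ⟩⟩
    have h2 := (Nat.mul_le_mul_right (qInt q (r + 1)) (Finset.card_le_card hsub)).trans h
    have h2' : ((upShadow G (j + 1)).card : ℚ) * qInt q (r + 1) ≤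
      (upShadow G (j + 1 + 1)).card * qInt q (j + 1) := by exact_mod_cast h2
    have hj0 : (0 : ℚ) < qInt q (j + 1) := by exact_mod_cast qInt_succ_pos j
    have hr0 : (0 : ℚ) < qInt q (r + 1) := by exact_mod_cast qInt_succ_pos r
    have e : gaussBinom q (j + 1 + r) (j + 1) * qInt q (j + 1) =
        gaussBinom q (j + 1 + r) j * qInt q (r + 1) := by
      rw [gaussBinom_add, show j + 1 + r = j + (r + 1) by ring, gaussBinom_add,
        qFactorial_succ, qFactorial_succ]
      have h1 := qFactorial_pos (q := q) j
      have h3 := qFactorial_pos (q := q) r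
      push_cast
      field_simp
    have h3 := mul_lt_mul_of_pos_right hlt hj0
    have h4 := mul_le_mul_of_nonneg_right ih hr0.le
    linarith

end Shadow

/-! ### Cross-intersecting families and Erdős–Ko–Rado -/

section CrossIntersecting

variable {K C M : Type*} [Field K] [Finite K] [AddCommGroup C] [Module K C] [FiniteDimensional K C]
  [Fintype (Submodule K C)] [AddCommGroup M] [Module K M] [FiniteDimensional K M]

open Classical

theorem exists_linearEquiv_map_eq {E E' : Submodule K C} (h : finrank K E = finrank K E') :
    ∃ τ : C ≃ₗ[K] C, E.map (τ : C →ₗ[K] C) = E' := by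
  obtain ⟨F, hF⟩ := E.exists_isCompl
  obtain ⟨F', hF'⟩ := E'.exists_isCompl
  have h1 := Submodule.finrank_add_eq_of_isCompl hF
  have h2 := Submodule.finrank_add_eq_of_isCompl hF'
  let e1 : E ≃ₗ[K] E' := LinearEquiv.ofFinrankEq E E' h
  let e2 : F ≃ₗ[K] F' := LinearEquiv.ofFinrankEq F F' (by omega)
  refine ⟨((Submodule.prodEquivOfIsCompl E F hF).symm.trans (e1.prodCongr e2)).trans
    (Submodule.prodEquivOfIsCompl E' F' hF'), ?_⟩
  refine Submodule.eq_of_le_of_finrank_eq ?_ ?_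
  · rintro _ ⟨v, hv, rfl⟩
    have hs : (Submodule.prodEquivOfIsCompl E F hF).symm v = (⟨v, hv⟩, 0) :=
      Submodule.prodEquivOfIsCompl_symm_apply_left E F hF ⟨v, hv⟩
    simp [hs]
  · rw [LinearEquiv.finrank_map_eq, h]

/-- Automorphisms of C act transitively on subspaces of a given dimension, so the image of P under a
random isomorphism is uniformly distributed. -/
theorem card_linearEquiv_map_mem [Fintype (M ≃ₗ[K] C)] {k d : ℕ} (hC : finrank K C = k) (hd : d ≤ k)
    {P : Submodule K M} (hP : finrank K P = d) {H : Finset (Submodule K C)}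
    (hH : ∀ E ∈ H, finrank K E = d) :
    ((Finset.univ.filter fun ψ : M ≃ₗ[K] C => P.map (ψ : M →ₗ[K] C) ∈ H).card : ℚ) *
      gaussBinom (Nat.card K) k d = H.card * Fintype.card (M ≃ₗ[K] C) := by
  set I : Submodule K C → Finset (M ≃ₗ[K] C) := fun E =>
    Finset.univ.filter fun ψ : M ≃ₗ[K] C => P.map (ψ : M →ₗ[K] C) = E with hI
  have hconst (E E' : Submodule K C) (h : finrank K E = finrank K E') :
      (I E).card ≤ (I E').card := by
    obtain ⟨τ, hτ⟩ := exists_linearEquiv_map_eq h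
    refine Finset.card_le_card_of_injOn (fun ψ => ψ.trans τ) ?_ ?_
    · intro ψ hψ
      simp only [hI, Finset.coe_filter, Finset.mem_univ, true_and, Set.mem_ofPred_eq] at hψ ⊢
      rw [LinearEquiv.coe_trans, Submodule.map_comp, hψ, hτ]
    · intro ψ _ ψ' _ h
      ext v
      exact τ.injective (LinearEquiv.congr_fun h v)
  have hfib (H : Finset (Submodule K C)) :
      (Finset.univ.filter fun ψ : M ≃ₗ[K] C => P.map (ψ : M →ₗ[K] C) ∈ H).card =
        ∑ E ∈ H, (I E).card := by
    rw [Finset.card_eq_sum_card_fiberwise (f := fun ψ : M ≃ₗ[K] C => P.map (ψ : M →ₗ[K] C))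
      (t := H) (fun ψ hψ => by simpa using hψ)]
    refine Finset.sum_congr rfl fun E hE => ?_
    congr 1
    ext ψ
    simp only [Finset.mem_filter, Finset.mem_univ, true_and, hI]
    exact ⟨fun h => h.2, fun h => ⟨h ▸ hE, h⟩⟩
  have hall : (Finset.univ.filter fun ψ : M ≃ₗ[K] C => P.map (ψ : M →ₗ[K] C) ∈
      (Finset.univ.filter fun E : Submodule K C => ⊥ ≤ E ∧ E ≤ ⊤ ∧ finrank K E = 0 + d)) =
        Finset.univ := by
    ext ψ
    simp only [Finset.mem_filter, Finset.mem_univ, true_and, bot_le, le_top, iff_true, zero_add]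
    rw [LinearEquiv.finrank_map_eq, hP]
  have hN := card_between (K := K) (V := C) (X := ⊥) (T := ⊤) bot_le (finrank_bot K C)
    (by rw [finrank_top, hC, zero_add]) hd
  have hall' := congrArg Finset.card hall
  rw [hfib, Finset.card_univ] at hall'
  rcases H.eq_empty_or_nonempty with rfl | ⟨E₀, hE₀⟩
  · simp
  have hE (E : Submodule K C) (hE : finrank K E = d) : (I E).card = (I E₀).card :=
    le_antisymm (hconst _ _ (by rw [hE, hH _ hE₀])) (hconst _ _ (by rw [hE, hH _ hE₀]))
  rw [Finset.sum_congr rfl fun E h => hE E (by simpa using h), Finset.sum_const,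
    smul_eq_mul] at hall'
  rw [hfib, Finset.sum_congr rfl fun E h => hE E (hH E h), Finset.sum_const, smul_eq_mul, ← hN,
    ← hall']
  push_cast
  ring

theorem exists_submodule_finrank_eq {d : ℕ} (h : d ≤ finrank K M) :
    ∃ S : Submodule K M, finrank K S = d := by
  obtain ⟨f, hf⟩ := exists_linearIndependent_of_le_finrank h
  exact ⟨Submodule.span K (Set.range f), by simpa using finrank_span_eq_card hf⟩

theorem exists_field_extension (K : Type*) [Field K] [Finite K] {j : ℕ} (hj : 1 ≤ j) :
    ∃ (L : Type) (_ : Field L) (_ : Algebra K L), finrank K L = j := by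
  have : Fact (ringChar K).Prime := ⟨CharP.char_is_prime K (ringChar K)⟩
  have : NeZero j := ⟨by omega⟩
  exact ⟨FiniteField.Extension K (ringChar K) j, inferInstance, inferInstance,
    FiniteField.finrank_extension K (ringChar K) j⟩

/-- A cross-intersecting inequality, from averaging over the images of a partial spread. -/
theorem card_add_pow_mul_card_le {i j : ℕ} (hi : 1 ≤ i) (hij : i ≤ j)
    (hC : finrank K C = i + j) {G H : Finset (Submodule K C)}
    (hG : ∀ U ∈ G, finrank K U = i) (hH : ∀ W ∈ H, finrank K W = j)
    (hGG : ∀ U ∈ G, ∀ U' ∈ G, U ⊓ U' ≠ ⊥) (hGH : ∀ U ∈ G, ∀ W ∈ H, U ⊓ W ≠ ⊥) :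
    (H.card : ℚ) + (Nat.card K : ℚ) ^ j * G.card ≤ gaussBinom (Nat.card K) (i + j) i := by
  obtain ⟨L, _, _, hL⟩ := exists_field_extension K (hi.trans hij)
  have : FiniteDimensional K L := FiniteDimensional.of_finrank_pos (by omega)
  have : Finite L := Module.finite_of_finite K
  have : Fintype L := Fintype.ofFinite L
  obtain ⟨S, hS⟩ := exists_submodule_finrank_eq (K := K) (M := L) (d := i) (by omega)
  have : Finite C := Module.finite_of_finite K
  have : Finite (S × L) := Module.finite_of_finite K
  have : Finite ((S × L) ≃ₗ[K] C) := DFunLike.finite _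
  have : Fintype ((S × L) ≃ₗ[K] C) := Fintype.ofFinite _
  have hM : finrank K (S × L) = i + j := by rw [finrank_prod, hS, hL]
  -- With L the extension of degree j and S ≤ L of dimension i, the graphs of the multiplications by
  -- a ∈ L are q^j pairwise skew i-spaces, each skew to the j-space 0 × L.
  set f : L → S →ₗ[K] S × L := fun a =>
    LinearMap.prod LinearMap.id ((LinearMap.mulLeft K a).comp S.subtype) with hf
  set W : Submodule K (S × L) := LinearMap.range (LinearMap.inr K S L) with hW
  set U : L → Submodule K (S × L) := fun a => LinearMap.range (f a) with hU
  have hWr : finrank K W = j := by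
    rw [hW, LinearMap.finrank_range_of_inj LinearMap.inr_injective, hL]
  have hUr (a : L) : finrank K (U a) = i := by
    rw [← hS]
    refine LinearMap.finrank_range_of_inj fun s s' h => ?_
    simpa [hf] using congrArg Prod.fst h
  have hUW (a : L) : U a ⊓ W = ⊥ := by
    rw [Submodule.eq_bot_iff]
    rintro _ ⟨⟨s, rfl⟩, ⟨l, hl⟩⟩
    have : s = 0 := by simpa [hf] using (congrArg Prod.fst hl).symm
    rw [this, map_zero]
  have hUU (a b : L) (hab : a ≠ b) : U a ⊓ U b = ⊥ := by
    rw [Submodule.eq_bot_iff]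
    rintro _ ⟨⟨s, rfl⟩, ⟨s', hs'⟩⟩
    have h1 : s' = s := by simpa [hf] using congrArg Prod.fst hs'
    have h2 : b * s' = a * s := by simpa [hf] using congrArg Prod.snd hs'
    rw [h1] at h2
    have h3 : (s : L) = 0 := by
      by_contra h0
      exact hab (mul_right_cancel₀ h0 h2).symm
    have : s = 0 := Subtype.ext h3
    rw [this, map_zero]
  have hmap (ψ : (S × L) ≃ₗ[K] C) (P Q : Submodule K (S × L)) (h : P ⊓ Q = ⊥) :
      P.map (ψ : (S × L) →ₗ[K] C) ⊓ Q.map (ψ : (S × L) →ₗ[K] C) = ⊥ := by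
    rw [← Submodule.map_inf _ ψ.injective, h, Submodule.map_bot]
  -- Images of distinct spread elements are skew, so at most one of them can be selected by the two
  -- families.
  have hψ (ψ : (S × L) ≃ₗ[K] C) : (if W.map (ψ : (S × L) →ₗ[K] C) ∈ H then 1 else 0) +
      (Finset.univ.filter fun a : L => (U a).map (ψ : (S × L) →ₗ[K] C) ∈ G).card ≤ 1 := by
    split_ifs with h
    · rw [Finset.filter_false_of_mem]
      · simp
      · exact fun a _ ha => hGH _ ha _ h (hmap ψ _ _ (hUW a))
    · rw [zero_add, Finset.card_le_one]
      intro a ha b hb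
      rw [Finset.mem_filter] at ha hb
      by_contra hab
      exact hGG _ ha.2 _ hb.2 (hmap ψ _ _ (hUU a b hab))
  have hsum := Finset.sum_le_sum fun ψ (_ : ψ ∈ Finset.univ) => hψ ψ
  have hswap := Finset.sum_card_bipartiteAbove_eq_sum_card_bipartiteBelow
    (fun (ψ : (S × L) ≃ₗ[K] C) (a : L) => (U a).map (ψ : (S × L) →ₗ[K] C) ∈ G)
    (s := Finset.univ) (t := Finset.univ)
  unfold Finset.bipartiteAbove Finset.bipartiteBelow at hswap
  rw [Finset.sum_add_distrib, hswap, Finset.sum_const, smul_eq_mul, mul_one, Finset.card_univ,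
    ← Finset.card_filter] at hsum
  have hsum' : ((Finset.univ.filter fun ψ : (S × L) ≃ₗ[K] C =>
      W.map (ψ : (S × L) →ₗ[K] C) ∈ H).card : ℚ) + ∑ a : L, ((Finset.univ.filter
        fun ψ : (S × L) ≃ₗ[K] C => (U a).map (ψ : (S × L) →ₗ[K] C) ∈ G).card : ℚ) ≤
      Fintype.card ((S × L) ≃ₗ[K] C) := by exact_mod_cast hsum
  have hN := gaussBinom_pos (q := Nat.card K) (i + j) i
  have h1 := card_linearEquiv_map_mem (M := S × L) hC (by omega) hWr hH
  have h2 (a : L) := card_linearEquiv_map_mem (M := S × L) hC (by omega) (hUr a) hG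
  have hsymm := gaussBinom_symm (q := Nat.card K) (show i ≤ i + j by omega)
  rw [Nat.add_sub_cancel_left] at hsymm
  rw [hsymm] at h1
  have h3 := mul_le_mul_of_nonneg_right hsum' hN.le
  rw [add_mul, Finset.sum_mul, Finset.sum_congr rfl fun a _ => h2 a, h1, Finset.sum_const,
    Finset.card_univ, ← Nat.card_eq_fintype_card (α := L), natCard_eq_pow_finrank (K := K), hL,
    nsmul_eq_mul] at h3
  have hpos : (0 : ℚ) < Fintype.card ((S × L) ≃ₗ[K] C) := by
    have : Nonempty ((S × L) ≃ₗ[K] C) := ⟨LinearEquiv.ofFinrankEq _ _ (hM.trans hC.symm)⟩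
    exact_mod_cast Fintype.card_pos
  refine le_of_mul_le_mul_right ?_ hpos
  push_cast at h3
  linarith

/-- The Erdős–Ko–Rado theorem for subspaces. -/
theorem card_le_of_intersecting {i j : ℕ} (hij : i + 1 ≤ j)
    (hC : finrank K C = i + 1 + j) {G : Finset (Submodule K C)}
    (hG : ∀ U ∈ G, finrank K U = i + 1) (hGG : ∀ U ∈ G, ∀ U' ∈ G, U ⊓ U' ≠ ⊥) :
    (G.card : ℚ) ≤ gaussBinom (Nat.card K) (i + j) i := by
  by_contra hlt
  rw [not_le] at hlt
  obtain ⟨j, rfl⟩ := Nat.exists_eq_add_of_le' (show 1 ≤ j by omega)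
  -- The upper shadow of G in the complementary dimension still meets every member of G. If G
  -- exceeded the bound, the shadow would be too large for the cross-intersecting inequality.
  have h1 := gaussBinom_le_card_upShadow (k := i + (j + 1)) (by omega) hG hlt.le j (by omega)
    (by omega)
  have h2 := card_add_pow_mul_card_le (by omega) hij hC hG
    (H := upShadow G (j + 1)) (fun W hW => (mem_upShadow.1 hW).1) hGG ?_
  · have h3 := gaussBinom_pascal' (q := Nat.card K) i j
    have h4 := gaussBinom_symm (q := Nat.card K) (m := i + (j + 1)) (r := j) (by omega)
    rw [show i + (j + 1) - j = i + 1 by omega] at h4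
    rw [show i + 1 + (j + 1) = i + j + 2 by ring, h3] at h2
    rw [show i + (j + 1) = i + j + 1 by ring] at *
    have hq : (0 : ℚ) < (Nat.card K : ℚ) ^ (j + 1) := by
      have : 0 < Nat.card K := Nat.card_pos
      positivity
    have h5 := mul_lt_mul_of_pos_left hlt hq
    linarith
  · intro U hU W hW
    obtain ⟨-, U', hU', hle⟩ := mem_upShadow.1 hW
    intro hbot
    exact hGG U hU U' hU' (le_bot_iff.1 (hbot ▸ inf_le_inf_left U hle))

end CrossIntersecting

/-! ### Traces of claimants on a common member -/

section Claims

variable {K V : Type*} [Field K] [AddCommGroup V] [Module K V] [FiniteDimensional K V]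
  {k : ℕ} {F : Set (Submodule K V)} {A : Submodule K V}

theorem finrank_add_le_of_inf_eq_bot {X Y Z : Submodule K V} (hX : X ≤ Z) (hY : Y ≤ Z)
    (h : X ⊓ Y = ⊥) : finrank K X + finrank K Y ≤ finrank K Z := by
  have e := Submodule.finrank_sup_add_finrank_inf_eq X Y
  rw [h, finrank_bot] at e
  have := Submodule.finrank_mono (sup_le hX hY)
  omega

theorem sup_eq_of_inf_eq_bot {X Y Z : Submodule K V} (hX : X ≤ Z) (hY : Y ≤ Z)
    (h : X ⊓ Y = ⊥) (hr : finrank K Z ≤ finrank K X + finrank K Y) : X ⊔ Y = Z := by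
  have e := Submodule.finrank_sup_add_finrank_inf_eq X Y
  rw [h, finrank_bot] at e
  refine Submodule.eq_of_le_of_finrank_le (sup_le hX hY) (by omega)

theorem ne_bot_of_finrank_pos {X : Submodule K V} (h : 1 ≤ finrank K X) : X ≠ ⊥ := by
  rintro rfl
  simp at h

/-- In a covering triple free family, disjoint traces of two members on a third one do not
fill it. -/
theorem finrank_inf_add_finrank_inf_lt (hF : ∀ B ∈ F, finrank K B = k)
    (hfree : CoveringTripleFree F) {B C C' : Submodule K V} (hB : B ∈ F) (hC : C ∈ F)
    (hC' : C' ∈ F) (h1 : B ⊓ C ≠ ⊥) (h2 : B ⊓ C' ≠ ⊥) (h : (B ⊓ C) ⊓ (B ⊓ C') = ⊥) :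
    finrank K ↥(B ⊓ C) + finrank K ↥(B ⊓ C') < k := by
  by_contra hk
  refine hfree B hB C hC C' hC' ⟨?_, ?_, ?_,
    sup_eq_of_inf_eq_bot inf_le_left inf_le_left h (by rw [hF B hB]; omega), h⟩
  · rintro rfl
    exact h2 (by rwa [inf_idem, ← inf_assoc, inf_idem] at h)
  · rintro rfl
    exact h1 (by rwa [inf_idem, inf_right_comm, inf_idem] at h)
  · rintro rfl
    exact h1 (by rwa [inf_idem] at h)

theorem index_of_inf_ne_bot {B : Submodule K V} (h : A ⊓ B ≠ ⊥) :
    index F A B = finrank K ↥(B ⊓ A) := by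
  rw [index, if_pos h, inf_comm]

theorem index_le {B C : Submodule K V} (h : A ⊓ B = ⊥) (hC : C ∈ F) (hBC : B ⊓ C ≠ ⊥) :
    index F A B ≤ finrank K ↥(B ⊓ C) := by
  rw [index, if_neg (not_not.2 h)]
  exact Nat.sInf_le ⟨C, hC, hBC, rfl⟩

theorem mem_indexFamily_of_inf_eq_bot {B C : Submodule K V} (h : A ⊓ B = ⊥) :
    C ∈ indexFamily F A B ↔ C ∈ F ∧ finrank K ↥(B ⊓ C) = index F A B := by
  rw [indexFamily, if_neg (not_not.2 h)]; rfl

theorem mem_indexFamily_of_inf_ne_bot {B C : Submodule K V} (h : A ⊓ B ≠ ⊥) :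
    C ∈ indexFamily F A B ↔ C = A := by
  rw [indexFamily, if_pos h]; rfl

theorem mem_and_finrank_of_mem_indexFamily (hA : A ∈ F) {B C : Submodule K V}
    (hC : C ∈ indexFamily F A B) : C ∈ F ∧ finrank K ↥(B ⊓ C) = index F A B := by
  by_cases h : A ⊓ B = ⊥
  · exact (mem_indexFamily_of_inf_eq_bot h).1 hC
  · rw [mem_indexFamily_of_inf_ne_bot h] at hC
    subst hC
    exact ⟨hA, (index_of_inf_ne_bot h).symm⟩

/-- A member C witnessing one claim serves for every other claim of D. If X and Y are both skew to
A, then Y ∩ C and Y ∩ X are too large to be disjoint, so X meets C. Minimality of the index gives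
dim(X ∩ C) ≥ j, and D ∩ C = 0 gives the converse. If exactly one of X, Y is skew to A, the other has
disjoint traces on A and on the skew one that fill it, which is impossible. If neither is skew, then
C = A. -/
theorem finrank_inf_eq_index (hF : ∀ B ∈ F, finrank K B = k) (hfree : CoveringTripleFree F)
    (hA : A ∈ F) {X Y C D D' : Submodule K V} {j j' : ℕ} (hX : X ∈ F) (hY : Y ∈ F)
    (hXj : index F A X = j) (hYj : index F A Y = j') (hj' : 1 ≤ j')
    (hDD' : D ≤ D') (hDX : D ≤ X) (hDY : D' ≤ Y) (hD : finrank K D + j = k) (hD0 : D ≠ ⊥)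
    (hC : C ∈ indexFamily F A Y) (hDC : D' ⊓ C = ⊥)
    (h : k ≤ finrank K D + j' ∨ k ≤ j + j') : finrank K ↥(X ⊓ C) = j := by
  have hDXY : D ≤ Y ⊓ X := le_inf (hDD'.trans hDY) hDX
  have hXY : Y ⊓ X ≠ ⊥ := fun h0 => hD0 (le_bot_iff.1 (h0 ▸ hDXY))
  have hdXY := Submodule.finrank_mono hDXY
  obtain ⟨hCF, hYC⟩ := mem_and_finrank_of_mem_indexFamily hA hC
  rw [hYj] at hYC
  have hYC0 : Y ⊓ C ≠ ⊥ := ne_bot_of_finrank_pos (by omega)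
  -- The first alternative in `h` uses D ≤ Y ∩ X; the second uses that Y competes in the minimum
  -- defining the index of X.
  have hskew (h0 : A ⊓ X = ⊥) : k ≤ j' + finrank K ↥(Y ⊓ X) := by
    rcases h with h | h
    · omega
    · have := index_le h0 hY (by rwa [inf_comm])
      rw [inf_comm] at this
      omega
  by_cases hAY : A ⊓ Y = ⊥
  · by_cases hAX : A ⊓ X = ⊥
    · have hne : (Y ⊓ C) ⊓ (Y ⊓ X) ≠ ⊥ := fun h0 => by
        have := finrank_inf_add_finrank_inf_lt hF hfree hY hCF hX hYC0 hXY h0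
        have := hskew hAX
        omega
      have hXC : X ⊓ C ≠ ⊥ := fun h0 => hne <| by
        rw [← inf_inf_distrib_left, inf_comm C, h0, inf_bot_eq]
      have h1 := index_le hAX hCF hXC
      have h2 := finrank_add_le_of_inf_eq_bot hDX (inf_le_left : X ⊓ C ≤ X)
        (le_bot_iff.1 (hDC ▸ inf_le_inf hDD' inf_le_right))
      rw [hF X hX] at h2
      omega
    · exfalso
      have h1 := index_of_inf_ne_bot (F := F) hAX
      rw [inf_comm] at hAX
      have := finrank_inf_add_finrank_inf_lt hF hfree hX hA hY hAX (by rwa [inf_comm])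
        (by rw [← inf_inf_distrib_left, hAY, inf_bot_eq])
      rw [inf_comm X Y] at this
      omega
  · rw [mem_indexFamily_of_inf_ne_bot hAY] at hC
    subst hC
    by_cases hAX : C ⊓ X = ⊥
    · exfalso
      have := finrank_inf_add_finrank_inf_lt hF hfree hY hA hX hYC0 hXY
        (by rw [← inf_inf_distrib_left, hAX, inf_bot_eq])
      have := hskew hAX
      omega
    · rw [← hXj, index_of_inf_ne_bot hAX]

theorem eq_of_mem_starPart {B X D : Submodule K V} (hB : B ∈ starPart F) (hX : X ∈ F)
    (hDB : D ≤ B) (hDX : D ≤ X) (hD : D ≠ ⊥) : X = B := by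
  by_contra hne
  exact hD (le_bot_iff.1 (hB.2 X hX hne ▸ le_inf hDB hDX))

theorem mem_claimed_of_mem_starPart {B D : Submodule K V} (hB : B ∈ starPart F) :
    D ∈ claimed k F A B ↔ D ≤ B := by
  rw [claimed, if_pos hB]; rfl

theorem mem_claimed_of_notMem_starPart {B D : Submodule K V} (hB : B ∉ starPart F) :
    D ∈ claimed k F A B ↔ D ≤ B ∧ finrank K D + index F A B = k ∧
      ∃ C ∈ indexFamily F A B, D ⊓ C = ⊥ := by
  rw [claimed, if_neg hB]; rfl

theorem le_of_mem_claimed {B D : Submodule K V} (h : D ∈ claimed k F A B) : D ≤ B := by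
  by_cases hB : B ∈ starPart F
  · exact (mem_claimed_of_mem_starPart hB).1 h
  · exact ((mem_claimed_of_notMem_starPart hB).1 h).1

theorem finrank_comap_subtype (C Y : Submodule K V) :
    finrank K ↥(Y.comap C.subtype) = finrank K ↥(Y ⊓ C) := by
  rw [(Submodule.equivMapOfInjective C.subtype C.injective_subtype _).finrank_eq,
    Submodule.map_comap_subtype, inf_comm]

theorem comap_subtype_inf_ne_bot {C X Y : Submodule K V} (h : (C ⊓ X) ⊓ (C ⊓ Y) ≠ ⊥) :
    X.comap C.subtype ⊓ Y.comap C.subtype ≠ ⊥ := by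
  intro h0
  apply h
  rw [← inf_inf_distrib_left, ← Submodule.map_comap_subtype, Submodule.comap_inf, h0,
    Submodule.map_bot]

/-- If the traces of Y and Y' on C were disjoint, then Y ∩ C and Y ∩ Y' ≥ D would be disjoint and
fill Y, a covering triple. -/
theorem comap_inf_comap_ne_bot (hF : ∀ B ∈ F, finrank K B = k) (hfree : CoveringTripleFree F)
    {Y Y' C D : Submodule K V} (hY : Y ∈ F) (hY' : Y' ∈ F) (hC : C ∈ F) (hDY : D ≤ Y)
    (hDY' : D ≤ Y') (hD : D ≠ ⊥) (hYC : Y ⊓ C ≠ ⊥)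
    (hk : k ≤ finrank K ↥(Y ⊓ C) + finrank K D) :
    Y.comap C.subtype ⊓ Y'.comap C.subtype ≠ ⊥ := by
  apply comap_subtype_inf_ne_bot
  intro hbot
  have hYY' : D ≤ Y ⊓ Y' := le_inf hDY hDY'
  have hlt := finrank_inf_add_finrank_inf_lt hF hfree hY hC hY' hYC
    (fun h => hD (le_bot_iff.1 (h ▸ hYY')))
    (le_bot_iff.1 (hbot ▸ le_inf (le_inf (inf_le_left.trans inf_le_right)
      (inf_le_left.trans inf_le_left)) (le_inf (inf_le_left.trans inf_le_right)
      (inf_le_right.trans inf_le_right))))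
  have := Submodule.finrank_mono hYY'
  omega

/-- Both spaces are the direct sum of D and their trace on C. -/
theorem eq_of_comap_subtype_eq {C D X Y : Submodule K V} (hDC : D ⊓ C = ⊥)
    (hX : finrank K X = k) (hY : finrank K Y = k)
    (hDX : D ≤ X) (hDY : D ≤ Y) (hXr : k ≤ finrank K D + finrank K ↥(X ⊓ C))
    (hYr : k ≤ finrank K D + finrank K ↥(Y ⊓ C))
    (h : X.comap C.subtype = Y.comap C.subtype) : X = Y := by
  have h1 : C ⊓ X = C ⊓ Y := by
    rw [← Submodule.map_comap_subtype, h, Submodule.map_comap_subtype]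
  rw [inf_comm, inf_comm C] at h1
  rw [← sup_eq_of_inf_eq_bot hDX (inf_le_left : X ⊓ C ≤ X)
    (le_bot_iff.1 (hDC ▸ inf_le_inf_left D inf_le_right)) (by omega),
    ← sup_eq_of_inf_eq_bot hDY (inf_le_left : Y ⊓ C ≤ Y)
    (le_bot_iff.1 (hDC ▸ inf_le_inf_left D inf_le_right)) (by omega), h1]

end Claims

/-! ### Local bounds on the number of claimants -/

section Claimants

variable {K V : Type*} [Field K] [AddCommGroup V] [Module K V] [FiniteDimensional K V]
  [Fintype (Submodule K V)] {k : ℕ} {F : Set (Submodule K V)} {A : Submodule K V}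

open Classical

/-- The members of the family that claim `D`, as a finite set. -/
noncomputable def claimantFinset (k : ℕ) (F : Set (Submodule K V)) (A D : Submodule K V) :
    Finset (Submodule K V) :=
  Finset.univ.filter (· ∈ claimants k F A D)

theorem mem_claimantFinset {B D : Submodule K V} :
    B ∈ claimantFinset k F A D ↔ B ∈ F ∧ D ∈ claimed k F A B := by
  rw [claimantFinset, Finset.mem_filter]
  exact and_iff_right (Finset.mem_univ _)

theorem ncard_claimants (D : Submodule K V) :
    (claimants k F A D).ncard = (claimantFinset k F A D).card := by
  rw [← Set.ncard_coe_finset]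
  simp [claimantFinset]

theorem card_claimantFinset_le_one {B D E : Submodule K V} (hB : B ∈ starPart F) (hDB : D ≤ B)
    (hD : D ≠ ⊥) (hDE : D ≤ E) : (claimantFinset k F A E).card ≤ 1 := by
  rw [Finset.card_le_one]
  intro X hX Y hY
  rw [mem_claimantFinset] at hX hY
  rw [eq_of_mem_starPart hB hX.1 hDB (hDE.trans (le_of_mem_claimed hX.2)) hD,
    eq_of_mem_starPart hB hY.1 hDB (hDE.trans (le_of_mem_claimed hY.2)) hD]

/-- If no claimant of `D` belongs to the star part, the claimants of `D` have the index
determined by the dimension of `D`. -/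
theorem claimants_not_star {D X : Submodule K V}
    (hns : ∀ B ∈ starPart F, ¬ D ≤ B) (hX : X ∈ claimantFinset k F A D) :
    X ∈ F ∧ D ≤ X ∧ finrank K D + index F A X = k ∧ ∃ C ∈ indexFamily F A X, D ⊓ C = ⊥ := by
  rw [mem_claimantFinset] at hX
  have hXs : X ∉ starPart F := fun h => hns X h (le_of_mem_claimed hX.2)
  exact ⟨hX.1, (mem_claimed_of_notMem_starPart hXs).1 hX.2⟩

variable [Finite K]

theorem card_image_comap {C D : Submodule K V} {P : Finset (Submodule K V)} {d : ℕ}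
    (hF : ∀ B ∈ P, finrank K B = k) (hD : finrank K D + d = k) (hDC : D ⊓ C = ⊥)
    (hP : ∀ X ∈ P, D ≤ X ∧ finrank K ↥(X ⊓ C) = d) :
    (P.image fun X => X.comap C.subtype).card = P.card := by
  refine Finset.card_image_of_injOn fun X hX Y hY h => ?_
  have h1 := hP X hX
  have h2 := hP Y hY
  exact eq_of_comap_subtype_eq hDC (hF X hX) (hF Y hY) h1.1 h2.1 (by omega) (by omega) h

/-- The claimants of D' and D leave on a common C traces of dimensions i and j. Two disjoint traces
of these kinds would fill C, so `card_add_pow_mul_card_le` applies. If a star member contains D, it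
is the only member doing so, and both counts are at most 1. -/
theorem card_claimants_add_le (hF : ∀ B ∈ F, finrank K B = k) (hfree : CoveringTripleFree F)
    (hA : A ∈ F) {i j : ℕ} (hi : 1 ≤ i) (hij : i ≤ j) (hk : i + j = k) {D D' : Submodule K V}
    (hDD' : D ≤ D') (hD : finrank K D = i) (hD' : finrank K D' = j) :
    ((claimantFinset k F A D).card : ℚ) + (Nat.card K : ℚ) ^ j * (claimantFinset k F A D').card
      ≤ gaussBinom (Nat.card K) (i + j) i := by
  have hD0 : D ≠ ⊥ := ne_bot_of_finrank_pos (by omega)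
  have hD'0 : D' ≠ ⊥ := ne_bot_of_finrank_pos (by omega)
  have hq2 : 1 ≤ Nat.card K := Nat.card_pos
  have hqj : (0 : ℚ) ≤ (Nat.card K : ℚ) ^ j := by positivity
  by_cases hstar : ∃ B ∈ starPart F, D ≤ B
  · obtain ⟨B, hB, hDB⟩ := hstar
    have h1 : ((claimantFinset k F A D).card : ℚ) ≤ 1 := by
      exact_mod_cast card_claimantFinset_le_one hB hDB hD0 le_rfl
    have h2 : ((claimantFinset k F A D').card : ℚ) ≤ 1 := by
      exact_mod_cast card_claimantFinset_le_one hB hDB hD0 hDD'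
    obtain ⟨i, rfl⟩ := Nat.exists_eq_add_of_le' hi
    obtain ⟨j, rfl⟩ := Nat.exists_eq_add_of_le' (hi.trans hij)
    have h3 := gaussBinom_pascal' (q := Nat.card K) i j
    rw [show i + 1 + (j + 1) = i + j + 2 by ring, h3]
    have h4 := one_le_gaussBinom hq2 (show i + 1 ≤ i + j + 1 by omega)
    have h5 := one_le_gaussBinom hq2 (show i ≤ i + j + 1 by omega)
    have h6 := mul_le_mul_of_nonneg_left (h2.trans h5) hqj
    linarith
  push Not at hstar
  have hstar' : ∀ B ∈ starPart F, ¬ D' ≤ B := fun B hB h => hstar B hB (hDD'.trans h)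
  -- The member C need be skew to D' only when D' is claimed; otherwise C comes from a claimant of
  -- D.
  have hcard (C : Submodule K V) (hC : C ∈ F) (h1 : D' ⊓ C = ⊥ ∨ claimantFinset k F A D' = ∅)
      (h0 : D ⊓ C = ⊥)
      (hX : ∀ X ∈ claimantFinset k F A D, finrank K ↥(X ⊓ C) = j)
      (hY : ∀ Y ∈ claimantFinset k F A D', finrank K ↥(Y ⊓ C) = i) :
      ((claimantFinset k F A D).card : ℚ) +
        (Nat.card K : ℚ) ^ j * (claimantFinset k F A D').card
          ≤ gaussBinom (Nat.card K) (i + j) i := by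
    have hCk := hF C hC
    have : Finite V := Module.finite_of_finite K
    have : Fintype (Submodule K C) := Fintype.ofFinite _
    have e1 := card_image_comap (fun X hX => hF X (mem_claimantFinset.1 hX).1)
      (D := D) (C := C) (d := j) (by omega) h0
      (fun X hX' => ⟨le_of_mem_claimed (mem_claimantFinset.1 hX').2, hX X hX'⟩)
    have e2 : ((claimantFinset k F A D').image fun X => X.comap C.subtype).card =
        (claimantFinset k F A D').card := by
      rcases h1 with h1 | h1
      · exact card_image_comap (fun X hX => hF X (mem_claimantFinset.1 hX).1)
          (D := D') (C := C) (d := i) (by omega) h1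
          (fun X hX' => ⟨le_of_mem_claimed (mem_claimantFinset.1 hX').2, hY X hX'⟩)
      · simp [h1]
    rw [← e1, ← e2]
    refine card_add_pow_mul_card_le hi hij (by omega) ?_ ?_ ?_ ?_
    · simp only [Finset.forall_mem_image]
      exact fun Y h => (finrank_comap_subtype C Y).trans (hY Y h)
    · simp only [Finset.forall_mem_image]
      exact fun X h => (finrank_comap_subtype C X).trans (hX X h)
    · simp only [Finset.forall_mem_image]
      intro Y hYm Y' hYm'
      have hYc := claimants_not_star hstar' hYm
      have hYc' := claimants_not_star hstar' hYm'
      exact comap_inf_comap_ne_bot hF hfree hYc.1 hYc'.1 hC hYc.2.1 hYc'.2.1 hD'0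
        (ne_bot_of_finrank_pos (by rw [hY Y hYm]; omega)) (by rw [hY Y hYm]; omega)
    · simp only [Finset.forall_mem_image]
      intro Y hYm X hXm
      have hr := hY Y hYm
      have hr' := hX X hXm
      rw [inf_comm] at hr hr'
      apply comap_subtype_inf_ne_bot
      intro hbot
      have hlt := finrank_inf_add_finrank_inf_lt hF hfree hC (mem_claimantFinset.1 hYm).1
        (mem_claimantFinset.1 hXm).1
        (ne_bot_of_finrank_pos (by omega)) (ne_bot_of_finrank_pos (by omega)) hbot
      omega
  rcases (claimantFinset k F A D').eq_empty_or_nonempty with hY | ⟨Y, hY⟩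
  · rcases (claimantFinset k F A D).eq_empty_or_nonempty with hX | ⟨X, hX⟩
    · rw [hX, hY]
      simpa using (gaussBinom_pos _ _).le
    · obtain ⟨hXF, hDX, hXi, C, hC, hDC⟩ := claimants_not_star hstar hX
      refine hcard C (mem_and_finrank_of_mem_indexFamily hA hC).1 (Or.inr hY) hDC ?_ (by simp [hY])
      intro X' hX'
      obtain ⟨hXF', hDX', hXi', -⟩ := claimants_not_star hstar hX'
      exact finrank_inf_eq_index hF hfree hA hXF' hXF (by omega) (show _ = j by omega)
        (by omega) le_rfl hDX' hDX (by omega) hD0 hC hDC (Or.inl (by omega))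
  · obtain ⟨hYF, hDY, hYi, C, hC, hDC⟩ := claimants_not_star hstar' hY
    refine hcard C (mem_and_finrank_of_mem_indexFamily hA hC).1 (Or.inl hDC)
      (le_bot_iff.1 (hDC ▸ inf_le_inf_right C hDD')) ?_ ?_
    · intro X' hX'
      obtain ⟨hXF', hDX', hXi', -⟩ := claimants_not_star hstar hX'
      exact finrank_inf_eq_index hF hfree hA hXF' hYF (by omega) (show _ = i by omega)
        (by omega) hDD' hDX' hDY (by omega) hD0 hC hDC (Or.inr (by omega))
    · intro X' hX'
      obtain ⟨hXF', hDX', hXi', -⟩ := claimants_not_star hstar' hX'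
      exact finrank_inf_eq_index hF hfree hA hXF' hYF (by omega) (show _ = i by omega)
        (by omega) le_rfl hDX' hDY (by omega) hD'0 hC hDC (Or.inl (by omega))

/-- The traces of the claimants on a common C form an intersecting family of (i+1)-spaces in
dimension k, to which Erdős–Ko–Rado applies. -/
theorem card_claimants_le (hF : ∀ B ∈ F, finrank K B = k) (hfree : CoveringTripleFree F)
    (hA : A ∈ F) {i j : ℕ} (hij : i + 1 ≤ j) (hk : i + 1 + j = k) {D : Submodule K V}
    (hD : finrank K D = j) :
    ((claimantFinset k F A D).card : ℚ) ≤ gaussBinom (Nat.card K) (i + j) i := by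
  have hD0 : D ≠ ⊥ := ne_bot_of_finrank_pos (by omega)
  have hq2 : 1 ≤ Nat.card K := Nat.card_pos
  by_cases hstar : ∃ B ∈ starPart F, D ≤ B
  · obtain ⟨B, hB, hDB⟩ := hstar
    have h1 : ((claimantFinset k F A D).card : ℚ) ≤ 1 := by
      exact_mod_cast card_claimantFinset_le_one hB hDB hD0 le_rfl
    exact h1.trans (one_le_gaussBinom hq2 (by omega))
  push Not at hstar
  rcases (claimantFinset k F A D).eq_empty_or_nonempty with hY | ⟨Y, hY⟩
  · rw [hY]
    simpa using (gaussBinom_pos _ _).le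
  · obtain ⟨hYF, hDY, hYi, C, hC, hDC⟩ := claimants_not_star hstar hY
    have hCF := (mem_and_finrank_of_mem_indexFamily hA hC).1
    have hr (X) (hX : X ∈ claimantFinset k F A D) : finrank K ↥(X ⊓ C) = i + 1 := by
      obtain ⟨hXF', hDX', hXi', -⟩ := claimants_not_star hstar hX
      exact finrank_inf_eq_index hF hfree hA hXF' hYF (by omega) (show _ = i + 1 by omega)
        (by omega) le_rfl hDX' hDY (by omega) hD0 hC hDC (Or.inl (by omega))
    have hCk := hF C hCF
    have : Finite V := Module.finite_of_finite K
    have : Fintype (Submodule K C) := Fintype.ofFinite _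
    rw [← card_image_comap (fun X hX => hF X (mem_claimantFinset.1 hX).1)
      (D := D) (C := C) (d := i + 1) (by omega) hDC
      (fun X hX' => ⟨le_of_mem_claimed (mem_claimantFinset.1 hX').2, hr X hX'⟩)]
    refine card_le_of_intersecting hij (by omega) ?_ ?_
    · simp only [Finset.forall_mem_image]
      exact fun Y h => (finrank_comap_subtype C Y).trans (hr Y h)
    · simp only [Finset.forall_mem_image]
      intro Y hYm Y' hYm'
      have hYc := claimants_not_star hstar hYm
      have hYc' := claimants_not_star hstar hYm'
      exact comap_inf_comap_ne_bot hF hfree hYc.1 hYc'.1 hCF hYc.2.1 hYc'.2.1 hD0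
        (ne_bot_of_finrank_pos (by rw [hr Y hYm]; omega)) (by rw [hr Y hYm]; omega)

end Claimants

/-! ### Monotonicity of Gaussian binomials -/

section Numeric

variable {q : ℕ}

theorem gaussBinom_mono_left (m r d : ℕ) (h : r ≤ m) :
    gaussBinom q m r ≤ gaussBinom q (m + d) r := by
  induction d with
  | zero => exact le_rfl
  | succ d ih =>
    refine ih.trans ?_
    cases r with
    | zero => simp [gaussBinom_zero]
    | succ r =>
      obtain ⟨b, hb⟩ := Nat.exists_eq_add_of_le (show r + 1 ≤ m + d by omega)
      have h1 := gaussBinom_pascal' (q := q) r b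
      rw [show m + (d + 1) = r + b + 2 by omega, h1, show m + d = r + b + 1 by omega]
      have h2 := gaussBinom_pos (q := q) (r + b + 1) r
      have : (0 : ℚ) ≤ (q : ℚ) ^ (b + 1) * gaussBinom q (r + b + 1) r := by positivity
      linarith

theorem gaussBinom_le_gaussBinom {m i j : ℕ} (hij : i ≤ j) (hm : i + j ≤ m) :
    gaussBinom q m i ≤ gaussBinom q m j := by
  obtain ⟨d, rfl⟩ := Nat.exists_eq_add_of_le hij
  obtain ⟨c, rfl⟩ := Nat.exists_eq_add_of_le hm
  have h1 := gaussBinom_mono_left (q := q) (i + d) d (i + c) (by omega)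
  -- Both sides count flags of an i-space inside a j-space, where j = i + d; this reduces the claim
  -- to monotonicity in the upper index.
  have e1 : gaussBinom q (i + (i + d) + c) (i + d) * gaussBinom q (d + i) d =
      gaussBinom q (i + (i + d) + c) i * gaussBinom q (d + (i + c)) d := by
    rw [show i + (i + d) + c = i + d + (i + c) by ring, gaussBinom_add,
      show i + d + (i + c) = i + (d + (i + c)) by ring,
      gaussBinom_add i, gaussBinom_add, gaussBinom_add, add_comm i d]
    have h1 := qFactorial_pos (q := q) i
    have h2 := qFactorial_pos (q := q) d
    have h3 := qFactorial_pos (q := q) (d + i)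
    have h4 := qFactorial_pos (q := q) (i + c)
    have h5 := qFactorial_pos (q := q) (d + (i + c))
    field_simp
  rw [show i + d + (i + c) = d + (i + (i + c)) by ring, show i + d = d + i by ring] at h1
  have h2 := gaussBinom_mono_left (q := q) (d + i) d c (by omega)
  rw [show d + i + c = d + (i + c) by ring] at h2
  have h3 := gaussBinom_pos (q := q) (d + i) d
  have h4 := gaussBinom_pos (q := q) (i + (i + d) + c) i
  refine le_of_mul_le_mul_right ?_ h3
  rw [e1]
  exact mul_le_mul_of_nonneg_left h2 h4.le

end Numeric

open Classical in
/-- Weighted double counting in a biregular bipartite graph. -/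
theorem sum_le_of_biregular {α β : Type*} {s : Finset α} {t : Finset β} (R : α → β → Prop)
    {a b c N : ℚ} (ha : ∀ x ∈ s, ((t.filter fun y => R x y).card : ℚ) = a)
    (hb : ∀ y ∈ t, ((s.filter fun x => R x y).card : ℚ) = b) (ha0 : 0 < a) {f : α → ℚ} {g : β → ℚ}
    (h : ∀ x ∈ s, ∀ y ∈ t, R x y → f x + c * g y ≤ N) :
    t.card * ∑ x ∈ s, f x + c * s.card * ∑ y ∈ t, g y ≤ t.card * (s.card * N) := by
  have hswap (w : α → β → ℚ) : ∑ x ∈ s, ∑ y ∈ t.filter (fun y => R x y), w x y =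
      ∑ y ∈ t, ∑ x ∈ s.filter (fun x => R x y), w x y :=
    Finset.sum_comm' (by simp; tauto)
  have hcard : (s.card : ℚ) * a = t.card * b := by
    have := hswap fun _ _ => 1
    simp only [Finset.sum_const, nsmul_eq_mul, mul_one] at this
    rwa [Finset.sum_congr rfl ha, Finset.sum_congr rfl hb, Finset.sum_const, Finset.sum_const,
      nsmul_eq_mul, nsmul_eq_mul] at this
  have hle : ∑ x ∈ s, ∑ y ∈ t.filter (fun y => R x y), (f x + c * g y) ≤
      ∑ x ∈ s, ∑ y ∈ t.filter (fun y => R x y), N :=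
    Finset.sum_le_sum fun x hx => Finset.sum_le_sum fun y hy => by
      rw [Finset.mem_filter] at hy
      exact h x hx y hy.1 hy.2
  simp only [Finset.sum_add_distrib] at hle
  rw [hswap fun _ y => c * g y] at hle
  simp only [Finset.sum_const, nsmul_eq_mul] at hle
  rw [Finset.sum_congr rfl fun x hx => congrArg (· * f x) (ha x hx),
    Finset.sum_congr rfl fun x hx => congrArg (· * (c * g x)) (hb x hx),
    Finset.sum_congr rfl fun x hx => congrArg (· * N) (ha x hx), ← Finset.mul_sum,
    ← Finset.mul_sum, ← Finset.mul_sum, Finset.sum_const, nsmul_eq_mul] at hle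
  refine le_of_mul_le_mul_left ?_ ha0
  have ht : (0 : ℚ) ≤ t.card := by positivity
  have h1 := mul_le_mul_of_nonneg_left hle ht
  calc a * (t.card * ∑ x ∈ s, f x + c * s.card * ∑ y ∈ t, g y)
      = t.card * (a * ∑ x ∈ s, f x) + c * (s.card * a) * ∑ y ∈ t, g y := by ring
    _ = t.card * (a * ∑ x ∈ s, f x + b * (c * ∑ y ∈ t, g y)) := by rw [hcard]; ring
    _ ≤ t.card * (s.card * (a * N)) := h1
    _ = _ := by ring

/-! ### Double counting of claims on subspaces skew to A -/

section Skew

variable {K V : Type*} [Field K] [Finite K] [AddCommGroup V] [Module K V] [FiniteDimensional K V]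
  [Fintype (Submodule K V)] {k : ℕ} {F : Set (Submodule K V)} {A : Submodule K V}

open Classical

/-- The `d`-dimensional subspaces skew to `A`. -/
noncomputable def skewTo (A : Submodule K V) (d : ℕ) : Finset (Submodule K V) :=
  Finset.univ.filter fun D => finrank K D = d ∧ D ⊓ A = ⊥

theorem mem_skewTo {D : Submodule K V} {d : ℕ} :
    D ∈ skewTo A d ↔ finrank K D = d ∧ D ⊓ A = ⊥ := by
  simp [skewTo]

theorem card_skewTo_le {T : Submodule K V} {m d : ℕ} (hAT : A ≤ T) (hA : finrank K A = k)
    (hT : finrank K T = k + m) (hd : d ≤ m) :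
    (((skewTo A d).filter (· ≤ T)).card : ℚ) =
      (Nat.card K : ℚ) ^ (k * d) * gaussBinom (Nat.card K) m d := by
  rw [← card_inf_eq (x := 0) bot_le hAT (finrank_bot K V) (by rw [hA, zero_add])
    (by rw [hT, zero_add]) hd]
  congr 2
  ext D
  simp only [Finset.mem_filter, mem_skewTo, Finset.mem_univ, true_and, bot_le, zero_add]
  tauto

theorem card_skewTo {m d : ℕ} (hA : finrank K A = k) (hV : finrank K V = k + m) (hd : d ≤ m) :
    ((skewTo A d).card : ℚ) = (Nat.card K : ℚ) ^ (k * d) * gaussBinom (Nat.card K) m d := by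
  rw [← card_skewTo_le (T := ⊤) le_top hA (by rw [finrank_top, hV]) hd]
  congr 2
  ext D
  simp

theorem finrank_sup_of_mem_skewTo {d : ℕ} {D : Submodule K V} (hD : D ∈ skewTo A d) :
    finrank K ↥(A ⊔ D) = finrank K A + d := by
  rw [mem_skewTo] at hD
  have := Submodule.finrank_sup_add_finrank_inf_eq A D
  rw [inf_comm, hD.2, finrank_bot] at this
  omega

/-- For E ≥ D, being skew to A amounts to E ∩ (A + D) = D. -/
theorem card_skewTo_ge {m d r : ℕ} (hA : finrank K A = k) (hV : finrank K V = k + d + m)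
    (hr : r ≤ m) {D : Submodule K V} (hD : D ∈ skewTo A d) :
    (((skewTo A (d + r)).filter (D ≤ ·)).card : ℚ) =
      (Nat.card K : ℚ) ^ (k * r) * gaussBinom (Nat.card K) m r := by
  have hsup := finrank_sup_of_mem_skewTo hD
  rw [mem_skewTo] at hD
  rw [← card_inf_eq (x := d) (X := D) (A := A ⊔ D) (T := ⊤) le_sup_right le_top hD.1
    (by rw [hsup, hA, add_comm]) (by rw [finrank_top, hV]; ring) hr]
  congr 2
  ext E
  simp only [Finset.mem_filter, mem_skewTo, Finset.mem_univ, true_and, le_top]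
  constructor
  · rintro ⟨⟨h1, h2⟩, h3⟩
    refine ⟨h3, ?_, h1⟩
    rw [sup_comm, inf_comm, sup_inf_assoc_of_le A h3, inf_comm A, h2, sup_bot_eq]
  · rintro ⟨h3, h2, h1⟩
    refine ⟨⟨h1, le_bot_iff.1 ?_⟩, h3⟩
    rw [← hD.2, ← h2]
    exact le_inf (inf_le_inf_left E le_sup_left) inf_le_right

theorem card_skewTo_filter_le {d r : ℕ} {E : Submodule K V} (hE : E ∈ skewTo A d) (hr : r ≤ d) :
    (((skewTo A r).filter (· ≤ E)).card : ℚ) = gaussBinom (Nat.card K) d r := by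
  rw [mem_skewTo] at hE
  rw [← card_between (X := ⊥) (T := E) bot_le (finrank_bot K V) (by rw [hE.1, zero_add]) hr]
  congr 2
  ext D
  simp only [Finset.mem_filter, mem_skewTo, Finset.mem_univ, true_and, bot_le, zero_add]
  exact ⟨fun h => ⟨h.2, h.1.1⟩, fun h => ⟨⟨h.2,
    le_bot_iff.1 (hE.2 ▸ inf_le_inf_right A h.1)⟩, h.1⟩⟩

/-- The members of a layer other than `A`. -/
noncomputable def layerFinset (F : Set (Submodule K V)) (A : Submodule K V) (d : ℕ) :
    Finset (Submodule K V) :=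
  Finset.univ.filter fun B => B ∈ layer F A d ∧ B ≠ A

theorem mem_layerFinset {B : Submodule K V} {d : ℕ} :
    B ∈ layerFinset F A d ↔ B ∈ layer F A d ∧ B ≠ A := by
  simp [layerFinset]

theorem mem_of_mem_layer {B : Submodule K V} {d : ℕ} (h : B ∈ layer F A d) : B ∈ F := by
  rcases h with h | h
  · exact h.1
  · exact h.1

/-- The `d`-dimensional subspaces skew to `A` that are claimed by `B`. -/
noncomputable def claimedFinset (k : ℕ) (F : Set (Submodule K V)) (A B : Submodule K V) (d : ℕ) :
    Finset (Submodule K V) :=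
  (skewTo A d).filter (· ∈ claimed k F A B)

theorem mem_layerFinset_of_mem_claimantFinset {i j : ℕ} (hj : 1 ≤ j) (hk : i + j = k) {B D : Submodule K V} (hD : D ∈ skewTo A j)
    (hB : B ∈ claimantFinset k F A D) : B ∈ layerFinset F A i := by
  rw [mem_skewTo] at hD
  have hD0 : D ≠ ⊥ := ne_bot_of_finrank_pos (by omega)
  rw [mem_claimantFinset] at hB
  rw [mem_layerFinset]
  refine ⟨?_, ?_⟩
  · by_cases hs : B ∈ starPart F
    · exact Or.inr hs
    · have := ((mem_claimed_of_notMem_starPart hs).1 hB.2).2.1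
      exact Or.inl ⟨hB.1, hs, by omega⟩
  · rintro rfl
    have := le_of_mem_claimed hB.2
    rw [inf_eq_left.2 this] at hD
    exact hD0 hD.2

theorem sum_card_claimantFinset {i j : ℕ} (hj : 1 ≤ j) (hk : i + j = k) :
    ∑ D ∈ skewTo A j, (claimantFinset k F A D).card =
      ∑ B ∈ layerFinset F A i, (claimedFinset k F A B j).card := by
  have h := Finset.sum_card_bipartiteAbove_eq_sum_card_bipartiteBelow
    (fun D B : Submodule K V => D ∈ claimed k F A B) (s := skewTo A j) (t := layerFinset F A i)
  refine Eq.trans (Finset.sum_congr rfl fun D hD => ?_) h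
  congr 1
  ext B
  rw [Finset.mem_bipartiteAbove]
  refine ⟨fun hB => ⟨mem_layerFinset_of_mem_claimantFinset hj hk hD hB,
    (mem_claimantFinset.1 hB).2⟩, fun hB => mem_claimantFinset.2
      ⟨mem_of_mem_layer (mem_layerFinset.1 hB.1).1, hB.2⟩⟩

theorem exists_mem_indexFamily {B : Submodule K V} (hB : B ∈ F) (hB0 : B ≠ ⊥) :
    ∃ C, C ∈ indexFamily F A B := by
  by_cases h : A ⊓ B = ⊥
  · have hne : {d : ℕ | ∃ C ∈ F, B ⊓ C ≠ ⊥ ∧ finrank K ↥(B ⊓ C) = d}.Nonempty :=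
      ⟨_, B, hB, by rwa [inf_idem], rfl⟩
    obtain ⟨C, hC, -, hr⟩ := Nat.sInf_mem hne
    refine ⟨C, (mem_indexFamily_of_inf_eq_bot h).2 ⟨hC, ?_⟩⟩
    rw [hr, index, if_neg (not_not.2 h)]
  · exact ⟨A, (mem_indexFamily_of_inf_ne_bot h).2 rfl⟩

theorem card_claimedFinset_of_star (hA : A ∈ F) (hF : ∀ B ∈ F, finrank K B = k) {j : ℕ}
    (hjk : j ≤ k) {B : Submodule K V} (hB : B ∈ starPart F) (hBA : B ≠ A) :
    ((claimedFinset k F A B j).card : ℚ) = gaussBinom (Nat.card K) k j := by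
  rw [← card_skewTo_filter_le (A := A) (mem_skewTo.2 ⟨hF B hB.1, hB.2 A hA hBA.symm⟩) hjk,
    claimedFinset]
  simp only [mem_claimed_of_mem_starPart hB]

theorem inf_eq_bot_of_mem_claimed {B D : Submodule K V} (hs : B ∉ starPart F)
    (hD : D ∈ claimed k F A B) : D ⊓ A = ⊥ := by
  obtain ⟨hDB, -, C, hC, hDC⟩ := (mem_claimed_of_notMem_starPart hs).1 hD
  by_cases h : A ⊓ B = ⊥
  · refine le_bot_iff.1 (h ▸ ?_)
    rw [inf_comm]
    exact inf_le_inf_left A hDB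
  · rwa [(mem_indexFamily_of_inf_ne_bot h).1 hC] at hDC

theorem card_claimedFinset_of_not_star {i j : ℕ} (hk : i + j = k) {B : Submodule K V}
    (hs : B ∉ starPart F) (hi : index F A B = i) :
    (claimedFinset k F A B j).card = (claimed k F A B).ncard := by
  rw [← Set.ncard_coe_finset]
  congr 1
  ext D
  rw [Finset.mem_coe, claimedFinset, Finset.mem_filter, mem_skewTo, and_iff_right_iff_imp]
  intro hD
  have h := ((mem_claimed_of_notMem_starPart hs).1 hD).2.1
  exact ⟨by omega, inf_eq_bot_of_mem_claimed hs hD⟩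

/-- Outside the star part, the q^(ij) complements of B ∩ C in B are claimed, for one C in the index
family. -/
theorem pow_le_card_claimedFinset (hA : A ∈ F) (hF : ∀ B ∈ F, finrank K B = k)
    {i j : ℕ} (hj : 1 ≤ j) (hk : i + j = k) {B : Submodule K V} (hB : B ∈ layerFinset F A i) :
    (Nat.card K : ℚ) ^ (i * j) ≤ (claimedFinset k F A B j).card := by
  rw [mem_layerFinset] at hB
  have hBk := hF B (mem_of_mem_layer hB.1)
  by_cases hs : B ∈ starPart F
  · rw [card_claimedFinset_of_star hA hF (by omega) hs hB.2, ← hk, mul_comm, add_comm]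
    exact pow_le_gaussBinom j i
  · rcases hB.1 with ⟨hBF, -, hBi⟩ | h
    · obtain ⟨C, hC⟩ := exists_mem_indexFamily (A := A) hBF (ne_bot_of_finrank_pos (by omega))
      have hCi := (mem_and_finrank_of_mem_indexFamily hA hC).2
      have h := card_inf_eq (X := ⊥) (A := B ⊓ C) (T := B) (x := 0) (e := i) (m := j) (r := j)
        bot_le inf_le_left (finrank_bot K V) (by omega) (by omega) le_rfl
      rw [gaussBinom_self, mul_one] at h
      rw [← h]
      refine Nat.cast_le.2 (Finset.card_le_card fun D hD => ?_)
      simp only [Finset.mem_filter, Finset.mem_univ, true_and, zero_add] at hD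
      obtain ⟨-, hDB, hDC, hDj⟩ := hD
      have hcl : D ∈ claimed k F A B := by
        rw [mem_claimed_of_notMem_starPart hs]
        refine ⟨hDB, by omega, C, hC, ?_⟩
        rwa [← inf_assoc, inf_eq_left.2 hDB] at hDC
      rw [claimedFinset, Finset.mem_filter, mem_skewTo]
      exact ⟨⟨hDj, inf_eq_bot_of_mem_claimed hs hcl⟩, hcl⟩
    · exact absurd h hs

theorem pow_mul_card_layerFinset_le (hA : A ∈ F) (hF : ∀ B ∈ F, finrank K B = k)
    {i j : ℕ} (hj : 1 ≤ j) (hk : i + j = k) :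
    (Nat.card K : ℚ) ^ (i * j) * (layerFinset F A i).card ≤
      ∑ D ∈ skewTo A j, ((claimantFinset k F A D).card : ℚ) := by
  have h := sum_card_claimantFinset (F := F) (A := A) hj hk
  have h' : ∑ D ∈ skewTo A j, ((claimantFinset k F A D).card : ℚ) =
      ∑ B ∈ layerFinset F A i, ((claimedFinset k F A B j).card : ℚ) := by exact_mod_cast h
  rw [h', mul_comm, ← nsmul_eq_mul]
  exact Finset.card_nsmul_le_sum _ _ _ fun B hB => pow_le_card_claimedFinset hA hF hj hk hB

theorem sum_card_claimantFinset_le (hA : A ∈ F) (hF : ∀ B ∈ F, finrank K B = k)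
    (hfree : CoveringTripleFree F) {i j : ℕ} (hij : i + 1 ≤ j) (hk : i + 1 + j = k) :
    ∑ D ∈ skewTo A j, ((claimantFinset k F A D).card : ℚ) ≤
      (skewTo A j).card * gaussBinom (Nat.card K) (i + j) i := by
  rw [← nsmul_eq_mul]
  exact Finset.sum_le_card_nsmul _ _ _ fun D hD =>
    card_claimants_le hF hfree hA hij hk (mem_skewTo.1 hD).1

theorem sum_card_claimants_add_le (hA : A ∈ F) (hF : ∀ B ∈ F, finrank K B = k)
    (hfree : CoveringTripleFree F) {i j m : ℕ} (hi : 1 ≤ i) (hij : i ≤ j) (hk : i + j = k)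
    (hV : finrank K V = k + m) (hm : k ≤ m) :
    (skewTo A j).card * ∑ D ∈ skewTo A i, ((claimantFinset k F A D).card : ℚ) +
      (Nat.card K : ℚ) ^ j * (skewTo A i).card *
        ∑ D ∈ skewTo A j, ((claimantFinset k F A D).card : ℚ) ≤
      (skewTo A j).card * ((skewTo A i).card * gaussBinom (Nat.card K) (i + j) i) := by
  obtain ⟨r, rfl⟩ := Nat.exists_eq_add_of_le hij
  refine sum_le_of_biregular (fun D D' => D ≤ D')
    (a := (Nat.card K : ℚ) ^ (k * r) * gaussBinom (Nat.card K) (m - i) r)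
    (b := gaussBinom (Nat.card K) (i + r) i) ?_ ?_ ?_ ?_
  · exact fun D hD => card_skewTo_ge (hF A hA) (by omega) (by omega) hD
  · exact fun D' hD' => card_skewTo_filter_le hD' (by omega)
  · have h1 := gaussBinom_pos (q := Nat.card K) (m - i) r
    have h2 : 0 < Nat.card K := Nat.card_pos
    positivity
  · exact fun D hD D' hD' h => card_claimants_add_le hF hfree hA hi hij hk h
      (mem_skewTo.1 hD).1 (mem_skewTo.1 hD').1

end Skew

/-! ### Extra slack when A is skew to all other members -/

section IsolatedBase

variable {K V : Type*} [Field K] [Finite K] [AddCommGroup V] [Module K V] [FiniteDimensional K V]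
  [Fintype (Submodule K V)] {k : ℕ} {F : Set (Submodule K V)} {A : Submodule K V}

open Classical

/-- If all members but `A` are skew to `A`, a subspace that is claimed at all is claimed by
every member of the relevant layer that contains it. -/
theorem mem_claimantFinset_of_le (hA : A ∈ F) (hF : ∀ B ∈ F, finrank K B = k)
    (hfree : CoveringTripleFree F) (hskew : ∀ B ∈ F, B ≠ A → A ⊓ B = ⊥) {i j : ℕ} (hi : 1 ≤ i)
    (hj : 1 ≤ j) (hk : i + j = k) {B D : Submodule K V} (hD : finrank K D = j)
    (hB : B ∈ layerFinset F A i) (hDB : D ≤ B) (hne : (claimantFinset k F A D).Nonempty) :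
    B ∈ claimantFinset k F A D := by
  have hD0 : D ≠ ⊥ := ne_bot_of_finrank_pos (by omega)
  rw [mem_layerFinset] at hB
  have hBF := mem_of_mem_layer hB.1
  rw [mem_claimantFinset]
  refine ⟨hBF, ?_⟩
  by_cases hs : B ∈ starPart F
  · exact (mem_claimed_of_mem_starPart hs).2 hDB
  obtain ⟨-, -, hBi⟩ | h := hB.1
  swap
  · exact absurd h hs
  obtain ⟨Y, hY⟩ := hne
  rw [mem_claimantFinset] at hY
  by_cases hYs : Y ∈ starPart F
  · exact absurd (eq_of_mem_starPart hYs hBF (le_of_mem_claimed hY.2) hDB hD0 ▸ hYs) hs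
  obtain ⟨hDY, hYi, C, hC, hDC⟩ := (mem_claimed_of_notMem_starPart hYs).1 hY.2
  have hr := finrank_inf_eq_index hF hfree hA hBF hY.1 hBi (show _ = i by omega) hi
    le_rfl hDB hDY (by omega) hD0 hC hDC (Or.inl (by omega))
  rw [mem_claimed_of_notMem_starPart hs]
  exact ⟨hDB, by omega, C, (mem_indexFamily_of_inf_eq_bot (hskew B hBF hB.2)).2
    ⟨(mem_and_finrank_of_mem_indexFamily hA hC).1, by omega⟩, hDC⟩

/-- The `d`-dimensional subspaces skew to `A` that nobody claims. -/
noncomputable def unclaimed (k : ℕ) (F : Set (Submodule K V)) (A : Submodule K V) (d : ℕ) :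
    Finset (Submodule K V) :=
  (skewTo A d).filter fun D => claimantFinset k F A D = ∅

/-- Each unclaimed D contributes nothing, so it loses a full share of the claim bound. -/
theorem card_unclaimed_mul_add_le (hA : A ∈ F) (hF : ∀ B ∈ F, finrank K B = k)
    (hfree : CoveringTripleFree F) {i j : ℕ} (hij : i + 1 ≤ j) (hk : i + 1 + j = k) :
    ((unclaimed k F A j).card : ℚ) * gaussBinom (Nat.card K) (i + j) i +
      (Nat.card K : ℚ) ^ ((i + 1) * j) * (layerFinset F A (i + 1)).card ≤
      (skewTo A j).card * gaussBinom (Nat.card K) (i + j) i := by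
  have h1 := pow_mul_card_layerFinset_le hA hF (show 1 ≤ j by omega) hk
  have h2 := Finset.card_filter_add_card_filter_not (s := skewTo A j)
    fun D => claimantFinset k F A D = ∅
  have h3 := Finset.sum_filter_add_sum_filter_not (skewTo A j)
    (fun D => claimantFinset k F A D = ∅) fun D => ((claimantFinset k F A D).card : ℚ)
  rw [Finset.sum_eq_zero fun D hD => by rw [(Finset.mem_filter.1 hD).2]; simp, zero_add] at h3
  have h4 := Finset.sum_le_card_nsmul ((skewTo A j).filter fun D => ¬ claimantFinset k F A D = ∅)
    (fun D => ((claimantFinset k F A D).card : ℚ)) (gaussBinom (Nat.card K) (i + j) i)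
    fun D hD => card_claimants_le hF hfree hA hij hk (mem_skewTo.1 (Finset.mem_filter.1 hD).1).1
  rw [nsmul_eq_mul] at h4
  rw [← h2, unclaimed]
  push_cast
  linarith

theorem card_skewTo_mul {j i m : ℕ} (hA : finrank K A = k) (hk : i + 1 + j = k)
    (hV : finrank K V = k + m) (hm : k ≤ m) (b : ℚ) :
    ((skewTo A j).card : ℚ) * b = (Nat.card K : ℚ) ^ ((i + 1) * j) *
      ((Nat.card K : ℚ) ^ (j ^ 2) * gaussBinom (Nat.card K) m j * b) := by
  rw [card_skewTo hA hV (by omega), ← hk,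
    show (i + 1 + j) * j = (i + 1) * j + j ^ 2 by ring, pow_add]
  ring

/-- Containments D ≤ B are counted instead of claims. A claimed D lies only in layer members that
claim it; an unclaimed D lies in at most as many as there are k-spaces through it skew to A. -/
theorem card_layerFinset_mul_le (hA : A ∈ F) (hF : ∀ B ∈ F, finrank K B = k)
    (hfree : CoveringTripleFree F) (hskew : ∀ B ∈ F, B ≠ A → A ⊓ B = ⊥) {i j m : ℕ}
    (hij : i + 1 ≤ j) (hk : i + 1 + j = k) (hV : finrank K V = k + m) (hm : k ≤ m) :
    ((layerFinset F A (i + 1)).card : ℚ) * gaussBinom (Nat.card K) k j ≤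
      (skewTo A j).card * gaussBinom (Nat.card K) (i + j) i + (unclaimed k F A j).card *
        ((Nat.card K : ℚ) ^ (k * (i + 1)) * gaussBinom (Nat.card K) (m - j) (i + 1)) := by
  have hsk (B) (hB : B ∈ layerFinset F A (i + 1)) : B ∈ skewTo A k := by
    rw [mem_layerFinset] at hB
    have hBF := mem_of_mem_layer hB.1
    exact mem_skewTo.2 ⟨hF B hBF, by rw [inf_comm]; exact hskew B hBF hB.2⟩
  have h := Finset.sum_card_bipartiteAbove_eq_sum_card_bipartiteBelow
    (fun D B : Submodule K V => D ≤ B) (s := skewTo A j) (t := layerFinset F A (i + 1))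
  have h' : ∑ D ∈ skewTo A j, (((layerFinset F A (i + 1)).filter (D ≤ ·)).card : ℚ) =
      ∑ B ∈ layerFinset F A (i + 1), (((skewTo A j).filter (· ≤ B)).card : ℚ) := by
    exact_mod_cast h
  rw [Finset.sum_congr rfl fun B hB => card_skewTo_filter_le (hsk B hB) (by omega : j ≤ k),
    Finset.sum_const, nsmul_eq_mul] at h'
  rw [← h', ← Finset.sum_filter_add_sum_filter_not (skewTo A j)
    (fun D => claimantFinset k F A D = ∅), add_comm]
  refine add_le_add ?_ ?_
  · have hle := Finset.sum_le_card_nsmul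
      ((skewTo A j).filter fun D => ¬ claimantFinset k F A D = ∅)
      (fun D => (((layerFinset F A (i + 1)).filter (D ≤ ·)).card : ℚ))
      (gaussBinom (Nat.card K) (i + j) i) fun D hD => ?_
    · refine hle.trans ?_
      rw [nsmul_eq_mul]
      have := gaussBinom_pos (q := Nat.card K) (i + j) i
      gcongr
      exact Finset.filter_subset _ _
    · rw [Finset.mem_filter, ← ne_eq, ← Finset.nonempty_iff_ne_empty] at hD
      have hDj := (mem_skewTo.1 hD.1).1
      refine le_trans (Nat.cast_le.2 (Finset.card_le_card fun B hB => ?_))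
        (card_claimants_le hF hfree hA hij hk hDj)
      rw [Finset.mem_filter] at hB
      exact mem_claimantFinset_of_le hA hF hfree hskew (by omega) (by omega) hk hDj hB.1 hB.2 hD.2
  · rw [← nsmul_eq_mul]
    refine Finset.sum_le_card_nsmul _ _ _ fun D hD => ?_
    have hD := (Finset.mem_filter.1 hD).1
    rw [← card_skewTo_ge (A := A) (m := m - j) (hF A hA) (by omega) (by omega) hD, add_comm j, hk]
    refine Nat.cast_le.2 (Finset.card_le_card fun B hB => ?_)
    rw [Finset.mem_filter] at hB ⊢
    exact ⟨hsk B hB.1, hB.2⟩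

theorem four_mul_le_pow_three {q : ℚ} (hq : 2 ≤ q) : 4 * q ≤ q ^ 3 := by
  have h : 4 ≤ q * q := by nlinarith
  have := mul_le_mul_of_nonneg_right h (by linarith : 0 ≤ q)
  linarith [pow_succ q 2, sq q]

theorem four_mul_add_one_lt_pow_four {q : ℚ} (hq : 2 ≤ q) : 4 * (q + 1) < q ^ 4 := by
  have h := mul_le_mul_of_nonneg_right (four_mul_le_pow_three hq) (by linarith : 0 ≤ q)
  have e : q ^ 3 * q = q ^ 4 := by ring
  rw [e] at h
  nlinarith

/-- Each B contains binom(k, j) subspaces of dimension j, noticeably more than the q^((i+1)j) used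
in the claim count. Few unclaimed D cannot absorb this difference. The 4 is chosen because only half
of a deficit survives in `sum_claimants_le`, and two copies of A must be paid for. -/
theorem card_layerFinset_add_four_lt (hA : A ∈ F) (hF : ∀ B ∈ F, finrank K B = k)
    (hfree : CoveringTripleFree F) (hskew : ∀ B ∈ F, B ≠ A → A ⊓ B = ⊥) {i j m : ℕ}
    (hij : i + 1 < j) (hk : i + 1 + j = k) (hV : finrank K V = k + m) (hm : k ≤ m) :
    ((layerFinset F A (i + 1)).card : ℚ) + 4 < (Nat.card K : ℚ) ^ (j ^ 2) *
      gaussBinom (Nat.card K) m j * gaussBinom (Nat.card K) (i + j) i := by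
  by_contra hlt
  rw [not_lt] at hlt
  have h1 := card_unclaimed_mul_add_le hA hF hfree hij.le hk
  have h2 := card_layerFinset_mul_le hA hF hfree hskew hij.le hk hV hm
  rw [card_skewTo_mul (hF A hA) hk hV hm] at h1 h2
  set q := Nat.card K with hq
  have hq2 : 2 ≤ q := one_lt_natCard
  have hq2' : (2 : ℚ) ≤ q := by exact_mod_cast hq2
  have hq1 : (1 : ℚ) ≤ q := by linarith
  obtain ⟨c, hc⟩ := Nat.exists_eq_add_of_le (show i + 1 ≤ m - j by omega)
  obtain ⟨j, rfl⟩ := Nat.exists_eq_add_of_le' (show 1 ≤ j by omega)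
  have h3 := pow_add_pow_le_gaussBinom (q := q) i j
  rw [← gaussBinom_symm (by omega), show i + j + 2 - (i + 1) = j + 1 by omega,
    show i + j + 2 = k by omega] at h3
  have h4 := pow_mul_gaussBinom_add_one_le (show 1 ≤ q by omega) i c j
  have h5 := gaussBinom_le_gaussBinom (q := q) (m := m) hij.le (by omega)
  rw [← hc, show m - (j + 1) + (j + 1) = m by omega] at h4
  have hb1 := one_le_gaussBinom (show 1 ≤ q by omega) (show i ≤ i + (j + 1) by omega)
  set b := gaussBinom q (i + (j + 1)) i with hb
  set t := gaussBinom q (m - (j + 1)) (i + 1) with ht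
  set N := gaussBinom q k (j + 1) with hN
  set W := (q : ℚ) ^ ((j + 1) ^ 2) * gaussBinom q m (j + 1) * b with hW
  set M := ((layerFinset F A (i + 1)).card : ℚ) with hM
  set Z := ((unclaimed k F A (j + 1)).card : ℚ) with hZ
  have ht0 : 0 < t := gaussBinom_pos _ _
  have hQ : (q : ℚ) ^ ((i + 1) * (j + 1)) = q * (q : ℚ) ^ ((i + 1) * (j + 1) - 1) := by
    rw [← pow_succ']
    congr 1
  set P := (q : ℚ) ^ ((i + 1) * (j + 1) - 1) with hP
  set Q := (q : ℚ) ^ ((i + 1) * (j + 1)) with hQ'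
  have hP0 : 0 < P := by positivity
  have hQ0 : 0 < Q := by positivity
  set s := (q : ℚ) ^ (k * (i + 1)) with hs
  have hs0 : 0 < s := by positivity
  have hZb : Z * b ≤ 4 * Q := by
    have := mul_le_mul_of_nonneg_left hlt hQ0.le
    linarith
  have hMN : b * ((W - 4) * N) ≤ b * (Q * W) + 4 * Q * (s * t) := by
    have e1 : (W - 4) * N ≤ M * N :=
      mul_le_mul_of_nonneg_right (by linarith) (gaussBinom_pos _ _).le
    have e2 := mul_le_mul_of_nonneg_left (e1.trans h2) (by linarith : (0 : ℚ) ≤ b)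
    have e3 := mul_le_mul_of_nonneg_right hZb (by positivity : (0 : ℚ) ≤ s * t)
    linarith
  have hz : 0 < N - Q := by linarith
  have hQz : Q ≤ q * (N - Q) := by
    refine hQ.le.trans ?_
    exact mul_le_mul_of_nonneg_left (by linarith) (by linarith)
  -- Division by N - Q, using Q/(N - Q) ≤ q and hence N/(N - Q) ≤ q + 1; the lower bound `hWge` on W
  -- contradicts this.
  have hkey : b * W ≤ 4 * b * (q + 1) + 4 * q * (s * t) := by
    refine le_of_mul_le_mul_right ?_ hz
    have e1 : b * W * (N - Q) ≤ 4 * b * N + 4 * Q * (s * t) := by linarith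
    have e2 := mul_le_mul_of_nonneg_right hQz (by positivity : (0 : ℚ) ≤ 4 * (s * t))
    have e3 := mul_le_mul_of_nonneg_right hQz (by positivity : (0 : ℚ) ≤ 4 * b)
    linarith
  have hWge : (q : ℚ) ^ ((j + 1) ^ 2) * (Q * t + 1) * b ≤ W := by
    have : (0 : ℚ) < (q : ℚ) ^ ((j + 1) ^ 2) := by positivity
    rw [hW]
    gcongr
    exact h4.trans h5
  have hexp : 4 * q * s ≤ (q : ℚ) ^ ((j + 1) ^ 2) * Q := by
    have e1 : (q : ℚ) ^ ((j + 1) ^ 2) * Q = (q : ℚ) ^ (k * (j + 1)) := by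
      rw [hQ', ← pow_add, ← hk]
      congr 1
      ring
    have e2 : (q : ℚ) ^ (k * (i + 1) + 3) ≤ (q : ℚ) ^ (k * (j + 1)) := by
      refine pow_le_pow_right₀ hq1 ?_
      have : k * (i + 2) ≤ k * (j + 1) := Nat.mul_le_mul_left k (by omega)
      nlinarith
    rw [e1]
    refine le_trans ?_ e2
    rw [pow_add, ← hs]
    rw [mul_comm]
    exact mul_le_mul_of_nonneg_left (four_mul_le_pow_three hq2') hs0.le
  have hfour : 4 * ((q : ℚ) + 1) < (q : ℚ) ^ ((j + 1) ^ 2) := by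
    have e : (q : ℚ) ^ 4 ≤ (q : ℚ) ^ ((j + 1) ^ 2) := by
      refine pow_le_pow_right₀ hq1 ?_
      have : 2 ≤ j + 1 := by omega
      nlinarith
    exact (four_mul_add_one_lt_pow_four hq2').trans_le e
  have hfin : b * ((q : ℚ) ^ ((j + 1) ^ 2) * (Q * t + 1) * b) ≤ b * W :=
    mul_le_mul_of_nonneg_left hWge (by linarith)
  have f1 : 4 * q * (s * t) ≤ (q : ℚ) ^ ((j + 1) ^ 2) * (Q * t) := by
    have := mul_le_mul_of_nonneg_right hexp ht0.le
    linarith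
  have hbb : b ≤ b * b := le_mul_of_one_le_left (by linarith) hb1
  have f2 : (q : ℚ) ^ ((j + 1) ^ 2) * (Q * t) ≤ (q : ℚ) ^ ((j + 1) ^ 2) * (Q * t) * (b * b) :=
    le_mul_of_one_le_right (by positivity) (hb1.trans hbb)
  have f3 : (q : ℚ) ^ ((j + 1) ^ 2) * b ≤ (q : ℚ) ^ ((j + 1) ^ 2) * (b * b) :=
    mul_le_mul_of_nonneg_left hbb (by positivity)
  have f4 := mul_lt_mul_of_pos_right hfour (show 0 < b by linarith)
  linarith

/-- Of the [m] hyperplanes through A, each D excludes [m-j], and [m] = [j] + q^j [m-j] exceeds q^j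
[m-j]. -/
theorem exists_hyperplane_avoiding {j m : ℕ} (hA : finrank K A = k)
    (hV : finrank K V = k + m) (hj : 1 ≤ j) (hjm : j < m) {Z : Finset (Submodule K V)}
    (hZ : ∀ D ∈ Z, D ∈ skewTo A j) (hcard : Z.card ≤ Nat.card K ^ j) :
    ∃ H, A ≤ H ∧ finrank K H + 1 = finrank K V ∧ ∀ D ∈ Z, ¬ D ≤ H := by
  by_contra hno
  push Not at hno
  set S := Finset.univ.filter fun H : Submodule K V =>
    A ≤ H ∧ H ≤ ⊤ ∧ finrank K H + 1 = finrank K (⊤ : Submodule K V) with hS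
  have h1 : S.card = qInt (Nat.card K) m := by
    have := card_hyperplanes (K := K) (V := V) (X := A) (T := ⊤) (s := m - 1) le_top
      (by rw [finrank_top]; omega)
    rwa [show m - 1 + 1 = m by omega] at this
  have h2 : S.card ≤ Z.card * qInt (Nat.card K) (m - j) := by
    have hsub : S ⊆ Z.biUnion fun D => S.filter (D ≤ ·) := by
      intro H hH
      have hH' := hH
      simp only [hS, Finset.mem_filter, Finset.mem_univ, true_and, finrank_top] at hH'
      obtain ⟨D, hD, hDH⟩ := hno H hH'.1 hH'.2.2
      exact Finset.mem_biUnion.2 ⟨D, hD, Finset.mem_filter.2 ⟨hH, hDH⟩⟩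
    refine (Finset.card_le_card hsub).trans (Finset.card_biUnion_le_card_mul _ _ _ fun D hD => ?_)
    have := card_hyperplanes (K := K) (V := V) (X := A ⊔ D) (T := ⊤) (s := m - j - 1) le_top
      (by rw [finrank_top, finrank_sup_of_mem_skewTo (hZ D hD)]; omega)
    rw [show m - j - 1 + 1 = m - j by omega] at this
    rw [← this]
    refine Finset.card_le_card fun H hH => ?_
    simp only [hS, Finset.mem_filter, Finset.mem_univ, true_and] at hH ⊢
    exact ⟨sup_le hH.1.1 hH.2, hH.1.2⟩
  have h3 : qInt (Nat.card K) m = qInt (Nat.card K) j +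
      Nat.card K ^ j * qInt (Nat.card K) (m - j) := by
    rw [← qInt_add]
    congr 1
    omega
  have h4 := qInt_pos (q := Nat.card K) hj
  have h5 := Nat.mul_le_mul_right (qInt (Nat.card K) (m - j)) hcard
  omega

/-- If the layer were this large, so few D would be unclaimed that some hyperplane H ≥ A contains
none of them. Every B meets H in dimension at least k - 1, so counting containments inside H bounds
the layer by the number of D skew to A in H, which is too small. -/
theorem card_layerFinset_add_one_lt (hA : A ∈ F) (hF : ∀ B ∈ F, finrank K B = k)
    (hfree : CoveringTripleFree F) (hskew : ∀ B ∈ F, B ≠ A → A ⊓ B = ⊥) {i m : ℕ}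
    (hk : i + 1 + (i + 1) = k) (hV : finrank K V = k + m) (hm : k ≤ m) :
    ((layerFinset F A (i + 1)).card : ℚ) + 1 < (Nat.card K : ℚ) ^ ((i + 1) ^ 2) *
      gaussBinom (Nat.card K) m (i + 1) * gaussBinom (Nat.card K) (i + (i + 1)) i := by
  by_contra hlt
  rw [not_lt] at hlt
  have h1 := card_unclaimed_mul_add_le hA hF hfree le_rfl hk
  rw [card_skewTo_mul (hF A hA) hk hV hm] at h1
  have hq2 : 2 ≤ Nat.card K := one_lt_natCard
  have hq2' : (2 : ℚ) ≤ Nat.card K := by exact_mod_cast hq2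
  have hq1 : (1 : ℚ) ≤ Nat.card K := by linarith
  have hb := pow_le_gaussBinom (q := Nat.card K) i (i + 1)
  have hb0 := gaussBinom_pos (q := Nat.card K) (i + (i + 1)) i
  have hQ0 : (0 : ℚ) < (Nat.card K : ℚ) ^ ((i + 1) * (i + 1)) := by positivity
  have hZ : (unclaimed k F A (i + 1)).card ≤ Nat.card K ^ (i + 1) := by
    rw [← Nat.cast_le (α := ℚ)]
    push_cast
    have hp : (0 : ℚ) < (Nat.card K : ℚ) ^ (i * (i + 1)) := by positivity
    have e : (Nat.card K : ℚ) ^ ((i + 1) * (i + 1)) =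
        (Nat.card K : ℚ) ^ (i + 1) * (Nat.card K : ℚ) ^ (i * (i + 1)) := by
      rw [← pow_add]; congr 1; ring
    refine le_of_mul_le_mul_right ?_ hp
    rw [← e]
    have h2 := mul_le_mul_of_nonneg_left hb
      (Nat.cast_nonneg (α := ℚ) (unclaimed k F A (i + 1)).card)
    have h3 := mul_le_mul_of_nonneg_left hlt hQ0.le
    linarith
  obtain ⟨H, hAH, hH, hHZ⟩ := exists_hyperplane_avoiding (hF A hA) hV (by omega) (by omega)
    (fun D hD => (Finset.mem_filter.1 hD).1) hZ
  obtain ⟨m, rfl⟩ := Nat.exists_eq_add_of_le' (show 1 ≤ m by omega)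
  have hcount : ((layerFinset F A (i + 1)).card : ℚ) * gaussBinom (Nat.card K) (i + (i + 1)) i ≤
      ((skewTo A (i + 1)).filter (· ≤ H)).card * gaussBinom (Nat.card K) (i + (i + 1)) i := by
    have h := Finset.sum_card_bipartiteAbove_eq_sum_card_bipartiteBelow
      (fun D B : Submodule K V => D ≤ B) (s := (skewTo A (i + 1)).filter (· ≤ H))
      (t := layerFinset F A (i + 1))
    have h' : ∑ D ∈ (skewTo A (i + 1)).filter (· ≤ H),
        (((layerFinset F A (i + 1)).filter (D ≤ ·)).card : ℚ) =
        ∑ B ∈ layerFinset F A (i + 1),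
          ((((skewTo A (i + 1)).filter (· ≤ H)).filter (· ≤ B)).card : ℚ) := by
      exact_mod_cast h
    rw [← nsmul_eq_mul, ← nsmul_eq_mul]
    refine (Finset.card_nsmul_le_sum _ _ _ fun B hB => ?_).trans
      (h'.symm.le.trans (Finset.sum_le_card_nsmul _ _ _ fun D hD => ?_))
    · rw [mem_layerFinset] at hB
      have hBF := mem_of_mem_layer hB.1
      have hBA := hskew B hBF hB.2
      have hBk := hF B hBF
      have hsup := Submodule.finrank_sup_add_finrank_inf_eq B H
      have hle := Submodule.finrank_le (B ⊔ H)
      have hcb := card_between (X := ⊥) (T := B ⊓ H) (x := 0) (r := i + 1) bot_le (finrank_bot K V)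
        (zero_add _).symm (by omega)
      have hmono := gaussBinom_mono_left (q := Nat.card K) (i + (i + 1)) (i + 1)
        (finrank K ↥(B ⊓ H) - (i + (i + 1))) (by omega)
      rw [show i + (i + 1) + (finrank K ↥(B ⊓ H) - (i + (i + 1))) = finrank K ↥(B ⊓ H) by omega,
        ← hcb, ← gaussBinom_symm (by omega), show i + (i + 1) - (i + 1) = i by omega] at hmono
      refine hmono.trans (Nat.cast_le.2 (Finset.card_le_card fun D hD => ?_))
      simp only [Finset.mem_filter, Finset.mem_univ, true_and, zero_add, mem_skewTo, bot_le,
        le_inf_iff] at hD ⊢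
      exact ⟨⟨⟨hD.2, le_bot_iff.1 (hBA ▸ le_inf inf_le_right (inf_le_left.trans hD.1.1))⟩,
        hD.1.2⟩, hD.1.1⟩
    · rw [Finset.mem_filter] at hD
      have hDj := (mem_skewTo.1 hD.1).1
      have hne : (claimantFinset k F A D).Nonempty := by
        rw [Finset.nonempty_iff_ne_empty]
        exact fun h0 => hHZ D (Finset.mem_filter.2 ⟨hD.1, h0⟩) hD.2
      refine le_trans (Nat.cast_le.2 (Finset.card_le_card fun B hB => ?_))
        (card_claimants_le hF hfree hA le_rfl hk hDj)
      rw [Finset.mem_filter] at hB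
      exact mem_claimantFinset_of_le hA hF hfree hskew (by omega) (by omega) hk hDj hB.1 hB.2 hne
  have hM := le_of_mul_le_mul_right hcount hb0
  rw [card_skewTo_le hAH (hF A hA) (m := m) (by omega) (by omega)] at hM
  obtain ⟨c, rfl⟩ := Nat.exists_eq_add_of_le (show i + 1 ≤ m by omega)
  have h2 := gaussBinom_pascal (q := Nat.card K) i c
  have h3 := one_le_gaussBinom (show 1 ≤ Nat.card K by omega) (show i ≤ i + c + 1 by omega)
  rw [show i + 1 + c + 1 = i + c + 2 by ring, h2] at hlt
  rw [show i + 1 + c = i + c + 1 by ring] at hM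
  set g := gaussBinom (Nat.card K) (i + c + 1) (i + 1) with hg
  set g' := gaussBinom (Nat.card K) (i + c + 1) i with hg'
  set b := gaussBinom (Nat.card K) (i + (i + 1)) i with hb'
  set q := (Nat.card K : ℚ) with hq
  have hg0 : 0 < g := gaussBinom_pos _ _
  have hp : q ≤ q ^ ((i + 1) ^ 2) := le_self_pow₀ hq1 (by positivity)
  have hb1 : 1 ≤ q ^ (i * (i + 1)) := one_le_pow₀ hq1
  have e : q ^ (k * (i + 1)) = q ^ ((i + 1) ^ 2) * q ^ (i + 1) * q ^ (i * (i + 1)) := by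
    rw [← pow_add, ← pow_add, ← hk]; congr 1; ring
  have f1 : q ^ ((i + 1) ^ 2) * (q ^ (i + 1) * g + g') * q ^ (i * (i + 1)) ≤
      q ^ ((i + 1) ^ 2) * (q ^ (i + 1) * g + g') * b := by gcongr
  have f2 : q ≤ q ^ ((i + 1) ^ 2) * g' * q ^ (i * (i + 1)) := by
    have e1 : q ^ ((i + 1) ^ 2) * 1 * 1 ≤ q ^ ((i + 1) ^ 2) * g' * q ^ (i * (i + 1)) := by gcongr
    linarith
  rw [e] at hM
  linarith

end IsolatedBase

/-- The weighted inequality lets Y exceed n₂b' by at most p n₂/n₁ ≤ 1/2 times the deficit of X below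
n₁b. -/
theorem add_le_of_weighted {n₁ n₂ b b' p X Y : ℚ} (hn : 0 < n₁) (hp : 2 * (p * n₂) ≤ n₁)
    (hX : X ≤ n₁ * b) (h : n₁ * Y + p * n₂ * X ≤ n₁ * (n₂ * (b' + p * b))) :
    X + Y ≤ n₁ * b + n₂ * b' - (n₁ * b - X) / 2 := by
  refine le_of_mul_le_mul_left ?_ hn
  have h1 := mul_nonneg (sub_nonneg.2 hX) (sub_nonneg.2 hp)
  nlinarith

/-! ### The global bound and the equality case -/

section Main

variable {K V : Type*} [Field K] [Finite K] [AddCommGroup V] [Module K V] [FiniteDimensional K V]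
  [Fintype (Submodule K V)] {k : ℕ} {F : Set (Submodule K V)} {A : Submodule K V}

open Classical

theorem two_mul_pow_mul_card_skewTo_le {i j m : ℕ} (hA : finrank K A = k) (hij : i + 1 < j)
    (hk : i + 1 + j = k) (hV : finrank K V = k + m) (hm : k ≤ m) :
    2 * ((Nat.card K : ℚ) ^ j * (skewTo A (i + 1)).card) ≤ (skewTo A j).card := by
  rw [card_skewTo hA hV (by omega), card_skewTo hA hV (by omega)]
  have hq2 : 2 ≤ Nat.card K := one_lt_natCard
  have hq2' : (2 : ℚ) ≤ Nat.card K := by exact_mod_cast hq2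
  have h1 := gaussBinom_le_gaussBinom (q := Nat.card K) (m := m) hij.le (by omega)
  have h0 := gaussBinom_pos (q := Nat.card K) m (i + 1)
  have h2 : (Nat.card K : ℚ) * ((Nat.card K : ℚ) ^ j * (Nat.card K : ℚ) ^ (k * (i + 1))) ≤
      (Nat.card K : ℚ) ^ (k * j) := by
    rw [← pow_add, ← pow_succ']
    refine pow_le_pow_right₀ (by linarith) ?_
    have : k * (i + 2) ≤ k * j := Nat.mul_le_mul_left k (by omega)
    nlinarith
  have h3 : 2 * ((Nat.card K : ℚ) ^ j * (Nat.card K : ℚ) ^ (k * (i + 1))) ≤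
      (Nat.card K : ℚ) ^ (k * j) := by
    refine le_trans ?_ h2
    gcongr
  calc _ = 2 * ((Nat.card K : ℚ) ^ j * (Nat.card K : ℚ) ^ (k * (i + 1))) *
        gaussBinom (Nat.card K) m (i + 1) := by ring
    _ ≤ _ := by gcongr

theorem gaussBinom_eq_add {q i j k : ℕ} (hj : 1 ≤ j) (hk : i + 1 + j = k) :
    gaussBinom q k (i + 1) = gaussBinom q (i + j) (i + 1) + (q : ℚ) ^ j * gaussBinom q (i + j) i := by
  obtain ⟨j, rfl⟩ := Nat.exists_eq_add_of_le' hj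
  rw [← hk, show i + 1 + (j + 1) = i + j + 2 by ring, gaussBinom_pascal']
  rfl

theorem gaussBinom_middle (q i : ℕ) :
    gaussBinom q (i + (i + 1)) (i + 1) = gaussBinom q (i + (i + 1)) i := by
  rw [← gaussBinom_symm (by omega), show i + (i + 1) - (i + 1) = i by omega]

/-- The sum over dimension j is replaced by any lower bound X, so that for isolated A the deficit
can be measured by the size of the layer. -/
theorem sum_claimants_le (hA : A ∈ F) (hF : ∀ B ∈ F, finrank K B = k)
    (hfree : CoveringTripleFree F) {i j m : ℕ} (hij : i + 1 < j) (hk : i + 1 + j = k)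
    (hV : finrank K V = k + m) (hm : k ≤ m) {X : ℚ}
    (hX : X ≤ ∑ D ∈ skewTo A j, ((claimantFinset k F A D).card : ℚ)) :
    X + ∑ D ∈ skewTo A (i + 1), ((claimantFinset k F A D).card : ℚ) ≤
      (skewTo A j).card * gaussBinom (Nat.card K) (i + j) i +
        (skewTo A (i + 1)).card * gaussBinom (Nat.card K) (i + j) (i + 1) -
      ((skewTo A j).card * gaussBinom (Nat.card K) (i + j) i - X) / 2 := by
  have h1 := sum_card_claimants_add_le hA hF hfree (by omega) hij.le hk hV hm
  have h2 := sum_card_claimantFinset_le hA hF hfree hij.le hk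
  have hcard := card_skewTo (d := j) (hF A hA) hV (by omega)
  have hq : 0 < Nat.card K := Nat.card_pos
  have hn : (0 : ℚ) < (skewTo A j).card := by
    rw [hcard]
    have := gaussBinom_pos (q := Nat.card K) m j
    positivity
  refine add_le_of_weighted hn (two_mul_pow_mul_card_skewTo_le (hF A hA) hij hk hV hm)
    (hX.trans h2) (le_trans ?_ (h1.trans_eq ?_))
  · gcongr
  · rw [hk, gaussBinom_eq_add (by omega) hk]

/-- The total number of claims, and what happens when it is extremal. -/
theorem sum_claimants_add_le (hA : A ∈ F) (hF : ∀ B ∈ F, finrank K B = k)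
    (hfree : CoveringTripleFree F) {i j m : ℕ} (hij : i + 1 ≤ j) (hk : i + 1 + j = k)
    (hV : finrank K V = k + m) (hm : k ≤ m) :
    (∑ D ∈ skewTo A j, ((claimantFinset k F A D).card : ℚ) +
      ∑ D ∈ skewTo A (i + 1), ((claimantFinset k F A D).card : ℚ) ≤
      (skewTo A j).card * gaussBinom (Nat.card K) (i + j) i +
        (skewTo A (i + 1)).card * gaussBinom (Nat.card K) (i + j) (i + 1)) ∧
    (∑ D ∈ skewTo A j, ((claimantFinset k F A D).card : ℚ) +
      ∑ D ∈ skewTo A (i + 1), ((claimantFinset k F A D).card : ℚ) =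
      (skewTo A j).card * gaussBinom (Nat.card K) (i + j) i +
        (skewTo A (i + 1)).card * gaussBinom (Nat.card K) (i + j) (i + 1) →
      ∑ D ∈ skewTo A j, ((claimantFinset k F A D).card : ℚ) =
        (skewTo A j).card * gaussBinom (Nat.card K) (i + j) i) := by
  have h2 := sum_card_claimantFinset_le hA hF hfree hij hk
  rcases hij.lt_or_eq with hlt | rfl
  · have h1 := sum_claimants_le hA hF hfree hlt hk hV hm le_rfl
    exact ⟨by linarith, fun h => by linarith⟩
  · rw [gaussBinom_middle]
    exact ⟨by linarith, fun h => by linarith⟩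

theorem card_layers_lt_of_isolated (hA : A ∈ F) (hF : ∀ B ∈ F, finrank K B = k)
    (hfree : CoveringTripleFree F) (hskew : ∀ B ∈ F, B ≠ A → A ⊓ B = ⊥) {i j m : ℕ}
    (hij : i + 1 ≤ j) (hk : i + 1 + j = k) (hV : finrank K V = k + m) (hm : k ≤ m) :
    (Nat.card K : ℚ) ^ ((i + 1) * j) *
      (((layerFinset F A (i + 1)).card + 1) + ((layerFinset F A j).card + 1)) <
      (skewTo A j).card * gaussBinom (Nat.card K) (i + j) i +
        (skewTo A (i + 1)).card * gaussBinom (Nat.card K) (i + j) (i + 1) := by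
  have hq : 0 < Nat.card K := Nat.card_pos
  have hQ : (0 : ℚ) < (Nat.card K : ℚ) ^ ((i + 1) * j) := by positivity
  rcases hij.lt_or_eq with hlt | rfl
  · have h1 := sum_claimants_le hA hF hfree hlt hk hV hm
      (pow_mul_card_layerFinset_le hA hF (by omega) hk)
    have h2 := pow_mul_card_layerFinset_le hA hF (i := j) (j := i + 1) (by omega)
      (by rw [add_comm]; exact hk)
    have h3 := card_layerFinset_add_four_lt hA hF hfree hskew hlt hk hV hm
    have h4 := mul_lt_mul_of_pos_left h3 hQ
    rw [← card_skewTo_mul (hF A hA) hk hV hm] at h4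
    rw [mul_comm j] at h2
    linarith
  · have h3 := card_layerFinset_add_one_lt hA hF hfree hskew hk hV hm
    have h4 := mul_lt_mul_of_pos_left h3 hQ
    rw [← card_skewTo_mul (hF A hA) hk hV hm] at h4
    rw [gaussBinom_middle]
    linarith

/-- The index of A relative to itself is k, so A lies in no layer with d < k. -/
theorem layer_eq_of_notMem_starPart (hA : A ∉ starPart F) (hAk : finrank K A = k) {d : ℕ}
    (hdk : d < k) : layer F A d = layerFinset F A d := by
  ext B
  rw [Finset.mem_coe, mem_layerFinset, iff_self_and]
  rintro (⟨-, -, h⟩ | h) rfl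
  · rw [index_of_inf_ne_bot, inf_idem, hAk] at h
    · omega
    · rw [inf_idem]
      exact ne_bot_of_finrank_pos (by omega)
  · exact hA h

theorem ncard_layer_of_mem_starPart (hA : A ∈ starPart F) (d : ℕ) :
    (layer F A d).ncard = (layerFinset F A d).card + 1 := by
  have h : layer F A d = ↑(insert A (layerFinset F A d)) := by
    ext B
    rw [Finset.mem_coe, Finset.mem_insert, mem_layerFinset]
    by_cases hB : B = A
    · subst hB
      simp [layer, hA]
    · simp [hB]
  rw [h, Set.ncard_coe_finset, Finset.card_insert_of_notMem]
  simp [mem_layerFinset]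

/-- Equality in the first sum makes every j-dimensional D' attain its bound. The trade-off with some
D' ≥ D then bounds each D by the average, so each D attains it. -/
theorem card_claimants_eq_of_sum_eq (hA : A ∈ F) (hF : ∀ B ∈ F, finrank K B = k)
    (hfree : CoveringTripleFree F) {i j m : ℕ} (hij : i + 1 ≤ j) (hk : i + 1 + j = k)
    (hV : finrank K V = k + m) (hm : k ≤ m)
    (h₁ : ∑ D ∈ skewTo A j, ((claimantFinset k F A D).card : ℚ) =
      (skewTo A j).card * gaussBinom (Nat.card K) (i + j) i)
    (h₂ : ∑ D ∈ skewTo A (i + 1), ((claimantFinset k F A D).card : ℚ) =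
      (skewTo A (i + 1)).card * gaussBinom (Nat.card K) (i + j) (i + 1))
    {D : Submodule K V} (hD : D ∈ skewTo A (i + 1)) :
    ((claimantFinset k F A D).card : ℚ) = gaussBinom (Nat.card K) (i + j) (i + 1) := by
  have hg : ∀ D' ∈ skewTo A j, ((claimantFinset k F A D').card : ℚ) =
      gaussBinom (Nat.card K) (i + j) i := by
    refine (Finset.sum_eq_sum_iff_of_le fun D' hD' =>
      card_claimants_le hF hfree hA hij hk (mem_skewTo.1 hD').1).1 ?_
    rw [h₁, Finset.sum_const, nsmul_eq_mul]
  refine (Finset.sum_eq_sum_iff_of_le fun D hD => ?_).1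
    (h₂.trans (by rw [Finset.sum_const, nsmul_eq_mul])) D hD
  obtain ⟨r, rfl⟩ := Nat.exists_eq_add_of_le hij
  have hne := card_skewTo_ge (m := m - (i + 1)) (r := r) (hF A hA) (by omega) (by omega) hD
  have hpos := gaussBinom_pos (q := Nat.card K) (m - (i + 1)) r
  have hq : 0 < Nat.card K := Nat.card_pos
  have hpos' : 0 < ((skewTo A (i + 1 + r)).filter (D ≤ ·)).card := by
    rw [← Nat.cast_pos (α := ℚ), hne]
    positivity
  obtain ⟨D', hD'⟩ := Finset.card_pos.1 hpos'
  rw [Finset.mem_filter] at hD'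
  have h := card_claimants_add_le hF hfree hA (by omega) hij hk hD'.2 (mem_skewTo.1 hD).1
    (mem_skewTo.1 hD'.1).1
  rw [hg D' hD'.1, hk, gaussBinom_eq_add (by omega) hk] at h
  linarith

theorem card_claimedFinset_eq_of_sum_eq (hA : A ∈ F) (hF : ∀ B ∈ F, finrank K B = k)
    {i j : ℕ} (hj : 1 ≤ j) (hk : i + j = k)
    (h : (Nat.card K : ℚ) ^ (i * j) * (layerFinset F A i).card =
      ∑ D ∈ skewTo A j, ((claimantFinset k F A D).card : ℚ)) {B : Submodule K V}
    (hB : B ∈ layerFinset F A i) :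
    ((claimedFinset k F A B j).card : ℚ) = (Nat.card K : ℚ) ^ (i * j) := by
  have hs := sum_card_claimantFinset (F := F) (A := A) hj hk
  have hs' : ∑ D ∈ skewTo A j, ((claimantFinset k F A D).card : ℚ) =
      ∑ B ∈ layerFinset F A i, ((claimedFinset k F A B j).card : ℚ) := by exact_mod_cast hs
  refine ((Finset.sum_eq_sum_iff_of_le fun B hB =>
    pow_le_card_claimedFinset hA hF hj hk hB).1 ?_ B hB).symm
  rw [← hs', ← h, Finset.sum_const, nsmul_eq_mul, mul_comm]

theorem starPart_eq_empty_of_card_eq (hA : A ∈ F) (hAs : A ∉ starPart F)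
    (hF : ∀ B ∈ F, finrank K B = k) {i j : ℕ} (hj : 1 ≤ j) (hk : i + 1 + j = k)
    (h : ∀ B ∈ layerFinset F A (i + 1),
      ((claimedFinset k F A B j).card : ℚ) = (Nat.card K : ℚ) ^ ((i + 1) * j)) :
    starPart F = ∅ := by
  rw [Set.eq_empty_iff_forall_notMem]
  intro B hB
  have hBA : B ≠ A := by
    rintro rfl
    exact hAs hB
  have h1 := h B (mem_layerFinset.2 ⟨Or.inr hB, hBA⟩)
  rw [card_claimedFinset_of_star hA hF (by omega) hB hBA, ← gaussBinom_symm (by omega),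
    -- A star member claims all its j-dimensional subspaces, which exceeds q^((i+1)j) strictly.
    show k - j = i + 1 by omega] at h1
  obtain ⟨j, rfl⟩ := Nat.exists_eq_add_of_le' hj
  have h2 := pow_add_pow_le_gaussBinom (q := Nat.card K) i j
  rw [show i + j + 2 = k by omega, h1] at h2
  have hq : 0 < Nat.card K := Nat.card_pos
  have h3 : (0 : ℚ) < (Nat.card K : ℚ) ^ ((i + 1) * (j + 1) - 1) := by positivity
  linarith

theorem ncard_claimed_eq (hstar : starPart F = ∅) {i j : ℕ} (hk : i + j = k)
    (hAs : A ∉ starPart F) (hAk : finrank K A = k) (hj : 1 ≤ j) {c : ℕ}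
    (h : ∀ B ∈ layerFinset F A i,
      ((claimedFinset k F A B j).card : ℚ) = (Nat.card K : ℚ) ^ c)
    {B : Submodule K V} (hB : B ∈ layer F A i) :
    (claimed k F A B).ncard = Nat.card K ^ c := by
  have hB' := hB
  rw [layer_eq_of_notMem_starPart hAs hAk (by omega), Finset.mem_coe] at hB'
  rcases hB with ⟨-, hs, hi⟩ | hs
  · rw [← card_claimedFinset_of_not_star hk hs hi]
    exact_mod_cast h B hB'
  · rw [hstar] at hs
    exact absurd hs (Set.notMem_empty B)

end Main

end CoveringTriple

theorem theorem4p8 {K V : Type*} [Field K] [Finite K] [AddCommGroup V] [Module K V]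
    [FiniteDimensional K V] (q n k : ℕ) (hq : Nat.card K = q) (hn : Module.finrank K V = n)
    (hk : 2 ≤ k) (hkn : 2 * k ≤ n)
    (F : Set (Submodule K V)) (hF : ∀ B ∈ F, Module.finrank K B = k)
    (hfree : CoveringTriple.CoveringTripleFree F)
    (A : Submodule K V) (hA : A ∈ F) (i : ℕ) (hi : 1 ≤ i) (hik : 2 * i ≤ k) :
    (((CoveringTriple.layer F A i).ncard : ℚ) + ((CoveringTriple.layer F A (k - i)).ncard : ℚ)
      ≤ (q : ℚ) ^ ((k - i) ^ 2) * CoveringTriple.gaussBinom q (n - k) (k - i)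
            * CoveringTriple.gaussBinom q (k - 1) (i - 1)
          + (q : ℚ) ^ (i ^ 2) * CoveringTriple.gaussBinom q (n - k) i
            * CoveringTriple.gaussBinom q (k - 1) i) ∧
    (((CoveringTriple.layer F A i).ncard : ℚ) + ((CoveringTriple.layer F A (k - i)).ncard : ℚ)
      = (q : ℚ) ^ ((k - i) ^ 2) * CoveringTriple.gaussBinom q (n - k) (k - i)
            * CoveringTriple.gaussBinom q (k - 1) (i - 1)
          + (q : ℚ) ^ (i ^ 2) * CoveringTriple.gaussBinom q (n - k) i
            * CoveringTriple.gaussBinom q (k - 1) i →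
      (∀ D : Submodule K V, Module.finrank K D = i → D ⊓ A = ⊥ →
        CoveringTriple.gaussBinom q (k - 1) i
          ≤ ((CoveringTriple.claimants k F A D).ncard : ℚ)) ∧
      CoveringTriple.starPart F = ∅ ∧
      ∀ B ∈ CoveringTriple.layer F A i ∪ CoveringTriple.layer F A (k - i),
        (CoveringTriple.claimed k F A B).ncard = q ^ (i * (k - i))) := by
  open CoveringTriple in
  have hVfin : Finite V := Module.finite_of_finite K
  have : Fintype (Submodule K V) := Fintype.ofFinite _
  obtain ⟨i, rfl⟩ := Nat.exists_eq_add_of_le' hi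
  obtain ⟨j, hj⟩ := Nat.exists_eq_add_of_le (show i + 1 ≤ k by omega)
  obtain ⟨m, hm⟩ := Nat.exists_eq_add_of_le (show k ≤ n by omega)
  rw [show k - (i + 1) = j by omega, show n - k = m by omega, show i + 1 - 1 = i by omega,
    show k - 1 = i + j by omega]
  have hV : Module.finrank K V = k + m := hn.trans hm
  have hkm : k ≤ m := by omega
  have hij : i + 1 ≤ j := by omega
  subst hq
  have hq : 0 < Nat.card K := Nat.card_pos
  have hQ : (0 : ℚ) < (Nat.card K : ℚ) ^ ((i + 1) * j) := by positivity
  have hAk := hF A hA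
  -- Multiplied by the minimal number of claims per member, the stated bound becomes the maximal
  -- total number of claims, since kj = (i+1)j + j² and k(i+1) = (i+1)j + (i+1)².
  have hW : (Nat.card K : ℚ) ^ ((i + 1) * j) * ((Nat.card K : ℚ) ^ (j ^ 2) *
      gaussBinom (Nat.card K) m j * gaussBinom (Nat.card K) (i + j) i +
      (Nat.card K : ℚ) ^ ((i + 1) ^ 2) * gaussBinom (Nat.card K) m (i + 1) *
      gaussBinom (Nat.card K) (i + j) (i + 1)) =
      (skewTo A j).card * gaussBinom (Nat.card K) (i + j) i +
        (skewTo A (i + 1)).card * gaussBinom (Nat.card K) (i + j) (i + 1) := by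
    rw [card_skewTo_mul hAk hj.symm hV hkm, card_skewTo hAk hV (show i + 1 ≤ m by omega), mul_add,
      hj, show (i + 1 + j) * (i + 1) = (i + 1) * j + (i + 1) ^ 2 by ring, pow_add]
    ring
  by_cases hAs : A ∈ starPart F
  · have hlt := card_layers_lt_of_isolated hA hF hfree
      (fun B hB hBA => hAs.2 B hB hBA) hij hj.symm hV hkm
    rw [← hW] at hlt
    have hlt' := lt_of_mul_lt_mul_left hlt hQ.le
    rw [ncard_layer_of_mem_starPart hAs, ncard_layer_of_mem_starPart hAs]
    push_cast
    exact ⟨hlt'.le, fun h => absurd h hlt'.ne⟩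
  · have e1 := layer_eq_of_notMem_starPart hAs hAk (show i + 1 < k by omega)
    have e2 := layer_eq_of_notMem_starPart hAs hAk (show j < k by omega)
    have hn1 : (layer F A (i + 1)).ncard = (layerFinset F A (i + 1)).card := by
      rw [e1, Set.ncard_coe_finset]
    have hn2 : (layer F A j).ncard = (layerFinset F A j).card := by
      rw [e2, Set.ncard_coe_finset]
    have hj' : j + (i + 1) = k := by omega
    have h1 := pow_mul_card_layerFinset_le hA hF (show 1 ≤ j by omega) hj.symm
    have h2 := pow_mul_card_layerFinset_le hA hF (show 1 ≤ i + 1 by omega) hj'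
    rw [mul_comm j] at h2
    obtain ⟨hle, heq⟩ := sum_claimants_add_le hA hF hfree hij hj.symm hV hkm
    rw [hn1, hn2]
    refine ⟨le_of_mul_le_mul_left ?_ hQ, fun h => ?_⟩
    · rw [hW, mul_add]
      linarith
    · have h' := congrArg ((Nat.card K : ℚ) ^ ((i + 1) * j) * ·) h
      rw [hW, mul_add] at h'
      -- Equality in the theorem squeezes the total number of claims to its maximum, so every
      -- inequality in the chain is tight.
      have hT := heq (by linarith)
      have hT1 : (Nat.card K : ℚ) ^ ((i + 1) * j) * (layerFinset F A (i + 1)).card =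
          ∑ D ∈ skewTo A j, ((claimantFinset k F A D).card : ℚ) := by linarith
      have hT2 : (Nat.card K : ℚ) ^ (j * (i + 1)) * (layerFinset F A j).card =
          ∑ D ∈ skewTo A (i + 1), ((claimantFinset k F A D).card : ℚ) := by
        rw [mul_comm j]; linarith
      have hc1 (B) (hB : B ∈ layerFinset F A (i + 1)) :=
        card_claimedFinset_eq_of_sum_eq hA hF (show 1 ≤ j by omega) hj.symm hT1 hB
      have hc2 (B) (hB : B ∈ layerFinset F A j) :=
        card_claimedFinset_eq_of_sum_eq hA hF (show 1 ≤ i + 1 by omega) hj' hT2 hB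
      have hstar := starPart_eq_empty_of_card_eq hA hAs hF (by omega) hj.symm hc1
      refine ⟨fun D hD hDA => ?_, hstar, ?_⟩
      · rw [ncard_claimants]
        exact (card_claimants_eq_of_sum_eq hA hF hfree hij hj.symm hV hkm hT
          (by linarith) (mem_skewTo.2 ⟨hD, hDA⟩)).ge
      · rintro B (hB | hB)
        · exact ncard_claimed_eq hstar hj.symm hAs hAk (by omega) hc1 hB
        · rw [mul_comm (i + 1)]
          exact ncard_claimed_eq hstar hj' hAs hAk (by omega) hc2 hB
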